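/- Let $p$ be a prime, let $S$ be an $\mathbb F_p$-scheme with absolute Frobenius $\operatorname{Fr}_S:S\to S$, and let $n\in\mathbb N$. For a group $S$-scheme $G$ and integers $0\le m\le n$ let $F^m:G\to(\operatorname{Fr}_S^m)^*G$ denote the ($m$-fold) relative Frobenius of $G$, and let $F^{n-m}:(\operatorname{Fr}_S^m)^*G\to(\operatorname{Fr}_S^n)^*G$ denote the relative Frobenius $F^{n-m}$ of $(\operatorname{Fr}_S^m)^*G$. A sequence of affine group $S$-schemes is called exact if the corresponding sequence of fpqc-sheaves of groups on the category of $S$-schemes is exact. A group $S$-scheme $G$ is called $n$-smooth if Zariski-locally on $S$ there exist an integer $r\ge 0$ and an isomorphism of pointed $S$-schemes $$G\simeq S\times_{\operatorname{Spec}\mathbb F_p}\operatorname{Spec} A_{n,r},\qquad A_{n,r}:=\mathbb F_p[x_1,\ldots,x_r]/(x_1^{p^n},\ldots,x_r^{p^n}),$$ where $G$ is pointed by its unit section and $\operatorname{Spec}A_{n,r}$ by the point $x_1=\dots=x_r=0$. Proposition. Let $G$ be a (not necessarily commutative) finite locally free group scheme over $S$ killed by $F^n$, i.e. such that $F^n:G\to(\operatorname{Fr}_S^n)^*G$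 is the trivial homomorphism. If the complex $$G\xrightarrow{F^m}(\operatorname{Fr}_S^m)^*G\xrightarrow{F^{n-m}}(\operatorname{Fr}_S^n)^*G$$ is exact for at least one $m\in\{1,\ldots,n-1\}$, then $G$ is $n$-smooth. -/

import Mathlib

open CategoryTheory Limits AlgebraicGeometry MonoidalCategory CartesianMonoidalCategory MonObj
open scoped Obj
open Opposite TopologicalSpace

universe u

namespace NSmooth

noncomputable section

/-! ### The absolute Frobenius -/

/-- The ring endomorphism `x ↦ x ^ (p ^ k)` of a commutative ring in which `p = 0`. -/
def ringFrob (p : ℕ) [Fact p.Prime] (k : ℕ) (R : Type u) [CommRing R] (hR : (p : R) = 0) :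
    R →+* R where
  toFun x := x ^ (p ^ k)
  map_one' := one_pow _
  map_mul' x y := mul_pow x y _
  map_zero' := zero_pow (pow_ne_zero k (Fact.out : p.Prime).ne_zero)
  map_add' x y := by
    obtain ⟨r, hr⟩ := exists_add_pow_prime_pow_eq (Fact.out : p.Prime) x y k
    rw [hr, hR]
    ring

lemma natCast_section (p : ℕ) (X : Scheme.{u}) (hX : (p : Γ(X, ⊤)) = 0) (U : X.Opens) :
    (p : Γ(X, U)) = 0 := by
  have h := congrArg (X.presheaf.map (homOfLE (le_top : U ≤ ⊤)).op).hom hX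
  simpa using h

/-- The morphism of presheafed spaces underlying the `k`-th power of the absolute Frobenius. -/
def absFrobPre (p : ℕ) [Fact p.Prime] (k : ℕ) (X : Scheme.{u}) (hX : (p : Γ(X, ⊤)) = 0) :
    X.toPresheafedSpace ⟶ X.toPresheafedSpace where
  base := 𝟙 _
  c :=
    { app := fun U => CommRingCat.ofHom
        (ringFrob p k Γ(X, U.unop) (natCast_section p X hX U.unop))
      naturality := fun U V f => by
        ext x
        exact map_pow (X.presheaf.map f).hom x (p ^ k) |>.symm }

/-- The `k`-th power `Fr^k : X ⟶ X` of the absolute Frobenius of a scheme `X` with `p = 0`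
in `𝒪_X`: the identity on the underlying space and `s ↦ s ^ (p ^ k)` on sections. -/
def absFrob (p : ℕ) [Fact p.Prime] (k : ℕ) (X : Scheme.{u}) (hX : (p : Γ(X, ⊤)) = 0) : X ⟶ X where
  toHom := absFrobPre p k X hX
  prop x := by
    refine ⟨fun a ha => ?_⟩
    obtain ⟨U, hx, s, rfl⟩ := TopCat.Presheaf.exists_germ_eq X.presheaf a
    have key : ((absFrobPre p k X hX).stalkMap x).hom (X.presheaf.germ U x hx s) =
        X.presheaf.germ U x hx s ^ (p ^ k) := by
      have h := congrArg (fun φ => φ.hom s)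
        (PresheafedSpace.stalkMap_germ (absFrobPre p k X hX) U x hx)
      exact h.trans (map_pow (X.presheaf.germ U x hx).hom s (p ^ k))
    have ha' : IsUnit (X.presheaf.germ U x hx s ^ (p ^ k)) := key ▸ ha
    exact (isUnit_pow_iff (pow_ne_zero k (Fact.out : p.Prime).ne_zero)).mp ha'

lemma natCast_of_hom {p : ℕ} {X Y : Scheme.{u}} (f : X ⟶ Y) (hY : (p : Γ(Y, ⊤)) = 0) :
    (p : Γ(X, ⊤)) = 0 := by
  have h := congrArg f.appTop.hom hY
  simpa using h

lemma absFrob_app (p : ℕ) [Fact p.Prime] (k : ℕ) (X : Scheme.{u}) (hX : (p : Γ(X, ⊤)) = 0)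
    (U : X.Opens) (s : Γ(X, U)) :
    ((absFrob p k X hX).app U).hom s = (s ^ (p ^ k) : Γ(X, U)) := rfl

lemma absFrob_naturality (p : ℕ) [Fact p.Prime] (k : ℕ) {X Y : Scheme.{u}} (f : X ⟶ Y)
    (hX : (p : Γ(X, ⊤)) = 0) (hY : (p : Γ(Y, ⊤)) = 0) :
    absFrob p k X hX ≫ f = f ≫ absFrob p k Y hY := by
  refine Scheme.Hom.ext (by rfl) fun U => ?_
  refine Eq.trans ?_ (Category.comp_id _)
  refine congrArg₂ (fun a b => a ≫ b) ?_ (X.presheaf.map_id _)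
  ext s
  exact (map_pow (f.app U).hom s (p ^ k)).symm

lemma absFrob_comp (p : ℕ) [Fact p.Prime] (k l : ℕ) (X : Scheme.{u}) (hX : (p : Γ(X, ⊤)) = 0) :
    absFrob p k X hX ≫ absFrob p l X hX = absFrob p (k + l) X hX := by
  refine Scheme.Hom.ext (by rfl) fun U => ?_
  refine Eq.trans ?_ (Category.comp_id _)
  refine congrArg₂ (fun a b => a ≫ b) ?_ (X.presheaf.map_id _)
  ext s
  refine Eq.trans (pow_mul s (p ^ l) (p ^ k)).symm ?_
  rw [← pow_add, add_comm]
  rfl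

/-! ### Frobenius twists and relative Frobenius -/

section Twist

variable (p : ℕ) [Fact p.Prime] {S : Scheme.{u}} (hS : (p : Γ(S, ⊤)) = 0)

/-- The base change `(Fr_S^k)^* X` of an `S`-scheme `X` along `Fr_S^k : S ⟶ S`. If `X` is a group
scheme then so is the base change, since the functor `Over.pullback` preserves finite products. -/
abbrev twist (k : ℕ) (X : Over S) : Over S := (Over.pullback (absFrob p k S hS)).obj X

/-- The projection `(Fr_S^k)^* X ⟶ X`, a morphism over `Fr_S^k : S ⟶ S`. -/
def twistProj (k : ℕ) (X : Over S) : (twist p hS k X).left ⟶ X.left :=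
  pullback.fst X.hom (absFrob p k S hS)

lemma twistProj_comp_hom (k : ℕ) (X : Over S) :
    twistProj p hS k X ≫ X.hom = (twist p hS k X).hom ≫ absFrob p k S hS :=
  pullback.condition

/-- The morphism of `S`-schemes `T ⟶ (Fr_S^k)^* X` given by a morphism `T ⟶ X` over `Fr_S^k`. -/
def twistLift (k : ℕ) {T X : Over S} (f : T.left ⟶ X.left)
    (hf : f ≫ X.hom = T.hom ≫ absFrob p k S hS) : T ⟶ twist p hS k X :=
  Over.homMk (pullback.lift f T.hom hf) (pullback.lift_snd _ _ _)

/-- The relative Frobenius `F^k : X ⟶ (Fr_S^k)^* X` of an `S`-scheme `X`: the morphism of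
`S`-schemes whose composite with the projection to `X` is `Fr_X^k`. -/
def relFrob (k : ℕ) (X : Over S) : X ⟶ twist p hS k X :=
  twistLift p hS k (absFrob p k X.left (natCast_of_hom X.hom hS))
    (absFrob_naturality p k X.hom _ hS)

/-- The canonical identification `(Fr_S^l)^* (Fr_S^k)^* X ⟶ (Fr_S^n)^* X`, where `k + l = n`. -/
def twistTwist (k l n : ℕ) (h : k + l = n) (X : Over S) :
    twist p hS l (twist p hS k X) ⟶ twist p hS n X :=
  twistLift p hS n (twistProj p hS l (twist p hS k X) ≫ twistProj p hS k X) (by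
    subst h
    rw [Category.assoc, twistProj_comp_hom, ← Category.assoc, twistProj_comp_hom, Category.assoc,
      absFrob_comp, add_comm l k])

/-- For `m ≤ n`, the morphism `F^(n-m) : (Fr_S^m)^* X ⟶ (Fr_S^n)^* X`, i.e. the relative
Frobenius `F^(n-m)` of `(Fr_S^m)^* X`. -/
def relFrobTwist {m n : ℕ} (h : m ≤ n) (X : Over S) : twist p hS m X ⟶ twist p hS n X :=
  relFrob p hS (n - m) (twist p hS m X) ≫
    twistTwist p hS m (n - m) n (Nat.add_sub_of_le h) X

/-- A group `S`-scheme `G` is killed by `F^n` if `F^n : G ⟶ (Fr_S^n)^* G` is trivial. -/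
def KilledByFrob (n : ℕ) (G : Over S) [GrpObj G] : Prop :=
  relFrob p hS n G = toUnit G ≫ η[twist p hS n G]

end Twist

/-! ### Exact sequences of group schemes -/

/-- Exactness of a sequence `G' ⟶ G ⟶ G''` of group `S`-schemes (with respect to homomorphisms
`f` and `h`) as a sequence of sheaves of groups for the fpqc topology on `S`-schemes: the
composite is trivial, and every `x ∈ G(T)` with trivial image in `G''(T)` comes from `G'`
locally on `T` for the fpqc topology. -/
structure FpqcExact {S : Scheme.{u}} {G' G G'' : Over S} [GrpObj G''] (f : G' ⟶ G) (h : G ⟶ G'') :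
    Prop where
  comp_trivial : f ≫ h = toUnit G' ≫ η[G'']
  locally_lifts : ∀ (T : Over S) (x : T ⟶ G), x ≫ h = toUnit T ≫ η[G''] →
    ∃ R ∈ Scheme.fpqcTopology.over S T, ∀ ⦃Y : Over S⦄ (g : Y ⟶ T), R g →
      ∃ y : Y ⟶ G', y ≫ f = g ≫ x

/-! ### `n`-smooth group schemes -/

/-- The field `𝔽_p`, in the universe `u`. -/
abbrev Fp (p : ℕ) : Type u := ULift.{u} (ZMod p)

lemma natCast_of_Fp {p : ℕ} {S : Scheme.{u}} (π : S ⟶ Spec (.of (Fp.{u} p))) :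
    (p : Γ(S, ⊤)) = 0 := by
  refine natCast_of_hom π ?_
  have h0 : (p : Fp.{u} p) = 0 := by
    apply ULift.down_injective
    simp
  have h := congrArg (Scheme.ΓSpecIso (.of (Fp.{u} p))).inv.hom h0
  rw [map_natCast, map_zero] at h
  exact h

/-- The ideal `(x_1^(p^n), …, x_r^(p^n))` of `𝔽_p[x_1, …, x_r]`. -/
def truncIdeal (p n r : ℕ) : Ideal (MvPolynomial (Fin r) (Fp.{u} p)) :=
  Ideal.span (Set.range fun i => MvPolynomial.X i ^ (p ^ n))

/-- The ring `A_{n,r} = 𝔽_p[x_1, …, x_r] / (x_1^(p^n), …, x_r^(p^n))`. -/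
abbrev TruncPoly (p n r : ℕ) : Type u :=
  MvPolynomial (Fin r) (Fp.{u} p) ⧸ truncIdeal.{u} p n r

/-- The augmentation `A_{n,r} →+* 𝔽_p`, `x_i ↦ 0`. -/
def truncAug (p : ℕ) [Fact p.Prime] (n r : ℕ) : TruncPoly.{u} p n r →+* Fp.{u} p :=
  Ideal.Quotient.lift (truncIdeal p n r) (MvPolynomial.aeval (fun _ => (0 : Fp.{u} p))).toRingHom
    (fun a ha => by
      have hle : truncIdeal p n r ≤
          RingHom.ker (MvPolynomial.aeval (R := Fp.{u} p) (fun _ : Fin r => (0 : Fp.{u} p))) := by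
        rw [truncIdeal, Ideal.span_le]
        rintro _ ⟨i, rfl⟩
        simp [RingHom.mem_ker, (Fact.out : p.Prime).ne_zero]
      exact hle ha)

/-- The structure morphism `Spec A_{n,r} ⟶ Spec 𝔽_p`. -/
def truncStr (p n r : ℕ) : Spec (.of (TruncPoly.{u} p n r)) ⟶ Spec (.of (Fp.{u} p)) :=
  Spec.map (CommRingCat.ofHom (algebraMap (Fp.{u} p) (TruncPoly.{u} p n r)))

/-- The point `Spec 𝔽_p ⟶ Spec A_{n,r}` given by `x_i ↦ 0`. -/
def truncPoint (p : ℕ) [Fact p.Prime] (n r : ℕ) :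
    Spec (.of (Fp.{u} p)) ⟶ Spec (.of (TruncPoly.{u} p n r)) :=
  Spec.map (CommRingCat.ofHom (truncAug p n r))

lemma truncPoint_comp_truncStr (p : ℕ) [Fact p.Prime] (n r : ℕ) :
    truncPoint.{u} p n r ≫ truncStr p n r = 𝟙 _ := by
  rw [truncPoint, truncStr, ← Spec.map_comp, ← CommRingCat.ofHom_comp]
  have : (truncAug.{u} p n r).comp (algebraMap (Fp.{u} p) (TruncPoly.{u} p n r)) =
      RingHom.id _ := by
    refine RingHom.ext fun a => ?_
    exact (MvPolynomial.aeval (R := Fp.{u} p) (fun _ : Fin r => (0 : Fp.{u} p))).commutes a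
  rw [this]
  exact Spec.map_id _

/-- The `U`-scheme `U × Spec A_{n,r}` (product over `Spec 𝔽_p`). -/
def truncOver (p n r : ℕ) {U : Scheme.{u}} (π : U ⟶ Spec (.of (Fp.{u} p))) : Over U :=
  Over.mk (pullback.fst π (truncStr p n r))

/-- The section of `U × Spec A_{n,r}` over `U` given by the point `x_i ↦ 0` of `Spec A_{n,r}`. -/
def truncSection (p : ℕ) [Fact p.Prime] (n r : ℕ) {U : Scheme.{u}}
    (π : U ⟶ Spec (.of (Fp.{u} p))) : 𝟙_ (Over U) ⟶ truncOver p n r π :=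
  Over.homMk (pullback.lift (𝟙 U) (π ≫ truncPoint p n r)
    (by
      rw [Category.assoc, truncPoint_comp_truncStr, Category.comp_id]
      exact Category.id_comp π))
    (pullback.lift_fst _ _ _)

/-- A group scheme `G` over an `𝔽_p`-scheme `S` is `n`-smooth if Zariski-locally on `S` there is
an isomorphism of pointed `S`-schemes `G ≅ S × Spec A_{n,r}` for some `r`; here `G` is
pointed by its unit section and `Spec A_{n,r}` by `x_i ↦ 0`. -/
def IsNSmooth (p : ℕ) [Fact p.Prime] {S : Scheme.{u}} (π : S ⟶ Spec (.of (Fp.{u} p))) (n : ℕ)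
    (G : Over S) [GrpObj G] : Prop :=
  ∀ s : S, ∃ U : S.Opens, s ∈ U ∧ ∃ (r : ℕ)
    (e : (Over.pullback U.ι).obj G ≅ truncOver p n r (U.ι ≫ π)),
    η[(Over.pullback U.ι).obj G] ≫ e.hom = truncSection p n r (U.ι ≫ π)

end

end NSmooth

/-! Write `I = ker ε` for the augmentation ideal of the coordinate ring `A` of `G` over an affine
open, and `I^[q]` for the ideal generated by `q`-th powers of elements of `I` (`frobIdeal`);
`I^[p^j]` cuts out the Frobenius kernel `G[F^j]`. Being killed by `F^n` means that `a ^ p^n = 0` for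
`a ∈ I`. So it suffices to find, near each point of `S`, elements `x_1, …, x_r` of `I` such that the
monomials with exponents `< p^n` form a basis of `A`.

On a geometric fibre, choose `x_i ∈ I` lifting a basis of `I / I^2`. These monomials span because
`I` is nilpotent, and they are independent as soon as the top one `∏ x_i^(p^n - 1)` is non-zero
(`linearIndependent_monom`).

The top monomial is handled one Frobenius kernel at a time (`monom_notMem_frobIdeal`): `∏ x_i^(p^j -
1) ∉ I^[p^j]` for `j ≤ n`. Three facts carry this. For `j = 1`, invariant derivations dual to the
`x_i` differentiate the monomial down to a unit (`monom_notMem_frobIdeal_one`). Invariance of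
`p^j`-th powers under translation by `G[F^j]` gives a cancellation rule: a `p^j`-th power whose
product with some `y ∉ I^[p^j]` lies in `I^[p^N]` lies there itself
(`pow_mem_frobIdeal_of_pow_mul_mem`). Finally, exactness says that `F^m` maps `G[F^(m+l)]` onto the
`F^l`-kernel of the twist for `l ≤ n - m`, so a relation `b^(p^m) ∈ I^[p^(m+l)]` descends to `b ∈
I^[p^l]` (`mem_frobIdeal_of_fpqcExact`).

A basis of the fibre of a flat finitely presented module spreads out to a neighbourhood
(`exists_notMem_basis_away`). What is retained of the group law is the pair of counit identities for
`Δ`. -/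

namespace NSmooth

noncomputable section

/-! ### Frobenius powers of ideals. -/

section FrobIdeal

variable {A B : Type*} [CommRing A] [CommRing B]

/-- The ideal generated by the `q`-th powers of the elements of an ideal. -/
def frobIdeal (I : Ideal A) (q : ℕ) : Ideal A := Ideal.span ((fun a => a ^ q) '' (I : Set A))

lemma pow_mem_frobIdeal {I : Ideal A} {a : A} (ha : a ∈ I) (q : ℕ) : a ^ q ∈ frobIdeal I q :=
  Ideal.subset_span ⟨a, ha, rfl⟩

lemma frobIdeal_le {I J : Ideal A} {q : ℕ} : frobIdeal I q ≤ J ↔ ∀ a ∈ I, a ^ q ∈ J := by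
  rw [frobIdeal, Ideal.span_le]
  exact Set.image_subset_iff

lemma frobIdeal_le_self {I : Ideal A} {q : ℕ} (hq : q ≠ 0) : frobIdeal I q ≤ I :=
  frobIdeal_le.2 fun _ ha => I.pow_mem_of_mem ha q (Nat.pos_of_ne_zero hq)

lemma frobIdeal_antitone (I : Ideal A) {p : ℕ} (hp : p ≠ 0) {i j : ℕ} (h : i ≤ j) :
    frobIdeal I (p ^ j) ≤ frobIdeal I (p ^ i) := by
  refine frobIdeal_le.2 fun a ha => ?_
  obtain ⟨l, rfl⟩ := Nat.exists_eq_add_of_le h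
  rw [pow_add, pow_mul]
  exact Ideal.pow_mem_of_mem _ (pow_mem_frobIdeal ha _) _ (Nat.pos_of_ne_zero (pow_ne_zero _ hp))

variable (p : ℕ) [ExpChar B p]

/-- The `p^j`-power map is additive on `B`, so the generators `f a` with `a ∈ I` suffice. -/
lemma pow_mem_map_frobIdeal (f : A →+* B) {I : Ideal A} (j : ℕ) {t : B} (ht : t ∈ I.map f) :
    t ^ p ^ j ∈ (frobIdeal I (p ^ j)).map f := by
  refine Submodule.span_induction (p := fun t _ => t ^ p ^ j ∈ (frobIdeal I (p ^ j)).map f)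
    ?_ ?_ ?_ ?_ ht
  · rintro _ ⟨a, ha, rfl⟩
    rw [← map_pow]
    exact Ideal.mem_map_of_mem f (pow_mem_frobIdeal ha _)
  · rw [zero_pow (pow_ne_zero _ (expChar_ne_zero B p))]
    exact zero_mem _
  · intro a b _ _ ha hb
    rw [add_pow_expChar_pow]
    exact add_mem ha hb
  · intro c a _ ha
    rw [smul_eq_mul, mul_pow]
    exact Ideal.mul_mem_left _ _ ha

end FrobIdeal

/-! ### Contracting one factor of `A ⊗ A` with a functional. -/

section Slice

open scoped TensorProduct

variable {k A : Type*} [Field k] [CommRing A] [Algebra k A]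

/-- The map `id ⊗ φ : A ⊗ A → A` for a linear functional `φ` on `A`. -/
def slice (φ : A →ₗ[k] k) : A ⊗[k] A →ₗ[k] A :=
  (TensorProduct.rid k A).toLinearMap ∘ₗ φ.lTensor A

@[simp] lemma slice_tmul (φ : A →ₗ[k] k) (a b : A) : slice φ (a ⊗ₜ b) = φ b • a := by
  simp [slice]

/-- The map `id ⊗ ε : A ⊗ A → A`, as a homomorphism of algebras. -/
def evalRight (ε : A →ₐ[k] k) : A ⊗[k] A →ₐ[k] A :=
  Algebra.TensorProduct.lift (AlgHom.id k A) ((Algebra.ofId k A).comp ε) fun _ _ => .all _ _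

/-- The map `ε ⊗ id : A ⊗ A → A`, as a homomorphism of algebras. -/
def evalLeft (ε : A →ₐ[k] k) : A ⊗[k] A →ₐ[k] A :=
  Algebra.TensorProduct.lift ((Algebra.ofId k A).comp ε) (AlgHom.id k A) fun _ _ => .all _ _

@[simp] lemma evalRight_tmul (ε : A →ₐ[k] k) (a b : A) : evalRight ε (a ⊗ₜ b) = ε b • a := by
  simp [evalRight, Algebra.ofId_apply, Algebra.smul_def, mul_comm]

@[simp] lemma evalLeft_tmul (ε : A →ₐ[k] k) (a b : A) : evalLeft ε (a ⊗ₜ b) = ε a • b := by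
  simp [evalLeft, Algebra.ofId_apply, Algebra.smul_def]

/-- The ideal `A ⊗ I` of `A ⊗ A`. -/
abbrev idealRight (I : Ideal A) : Ideal (A ⊗[k] A) :=
  I.map (Algebra.TensorProduct.includeRight (R := k) (A := A) (B := A)).toRingHom

/-- The ideal `I ⊗ A` of `A ⊗ A`. -/
abbrev idealLeft (I : Ideal A) : Ideal (A ⊗[k] A) :=
  I.map (Algebra.TensorProduct.includeLeft (R := k) (S := k) (A := A) (B := A)).toRingHom

lemma sub_evalRight_mem (ε : A →ₐ[k] k) (t : A ⊗[k] A) :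
    t - evalRight ε t ⊗ₜ 1 ∈ idealRight (k := k) (RingHom.ker ε) := by
  induction t with
  | zero => simp
  | add x y hx hy =>
    rw [map_add, TensorProduct.add_tmul, add_sub_add_comm]
    exact add_mem hx hy
  | tmul a b =>
    have h : (a ⊗ₜ b - evalRight ε (a ⊗ₜ[k] b) ⊗ₜ 1 : A ⊗[k] A) =
        (a ⊗ₜ 1) * (1 ⊗ₜ (b - algebraMap k A (ε b))) := by
      rw [evalRight_tmul, TensorProduct.smul_tmul, Algebra.TensorProduct.tmul_mul_tmul, _root_.mul_one,
        _root_.one_mul, TensorProduct.tmul_sub, Algebra.algebraMap_eq_smul_one]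
    rw [h]
    refine Ideal.mul_mem_left _ _ (Ideal.mem_map_of_mem
      (Algebra.TensorProduct.includeRight (R := k) (A := A) (B := A)).toRingHom ?_)
    simp [RingHom.mem_ker]

lemma sub_evalLeft_mem (ε : A →ₐ[k] k) (t : A ⊗[k] A) :
    t - 1 ⊗ₜ evalLeft ε t ∈ idealLeft (k := k) (RingHom.ker ε) := by
  induction t with
  | zero => simp
  | add x y hx hy =>
    rw [map_add, TensorProduct.tmul_add, add_sub_add_comm]
    exact add_mem hx hy
  | tmul a b =>
    have h : (a ⊗ₜ b - 1 ⊗ₜ evalLeft ε (a ⊗ₜ[k] b) : A ⊗[k] A) =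
        (1 ⊗ₜ b) * ((a - algebraMap k A (ε a)) ⊗ₜ 1) := by
      rw [evalLeft_tmul, ← TensorProduct.smul_tmul, Algebra.TensorProduct.tmul_mul_tmul, _root_.mul_one,
        _root_.one_mul, TensorProduct.sub_tmul, Algebra.algebraMap_eq_smul_one]
    rw [h]
    refine Ideal.mul_mem_left _ _ (Ideal.mem_map_of_mem
      (Algebra.TensorProduct.includeLeft (R := k) (S := k) (A := A) (B := A)).toRingHom ?_)
    simp [RingHom.mem_ker]

lemma slice_left_mul (φ : A →ₗ[k] k) (a : A) (t : A ⊗[k] A) :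
    slice φ ((a ⊗ₜ 1) * t) = a * slice φ t := by
  induction t with
  | zero => simp
  | add x y hx hy => rw [mul_add, map_add, map_add, mul_add, hx, hy]
  | tmul b c => simp

lemma slice_eq_zero_of_mem (φ : A →ₗ[k] k) {K : Ideal A} (hφ : ∀ a ∈ K, φ a = 0) {t : A ⊗[k] A}
    (ht : t ∈ idealRight (k := k) K) : slice φ t = 0 := by
  refine Submodule.span_induction (p := fun t _ => slice φ t = 0) ?_ ?_ ?_ ?_
    (Submodule.span_induction (p := fun t _ => t ∈ Submodule.span k
      {t : A ⊗[k] A | ∃ a, ∃ b ∈ K, a ⊗ₜ b = t}) ?_ ?_ ?_ ?_ ht)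
  · rintro _ ⟨a, b, hb, rfl⟩
    simp [hφ b hb]
  · simp
  · intro x y _ _ hx hy
    rw [map_add, hx, hy, add_zero]
  · intro c x _ hx
    rw [map_smul, hx, smul_zero]
  · rintro _ ⟨b, hb, rfl⟩
    exact Submodule.subset_span ⟨1, b, hb, rfl⟩
  · exact zero_mem _
  · intro x y _ _ hx hy
    exact add_mem hx hy
  · intro c x _ hx
    rw [smul_eq_mul]
    induction c with
    | zero => simp
    | add c d hc hd => rw [add_mul]; exact add_mem hc hd
    | tmul c d =>
      refine Submodule.span_induction (p := fun x _ => (c ⊗ₜ d) * x ∈ Submodule.span k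
        {t : A ⊗[k] A | ∃ a, ∃ b ∈ K, a ⊗ₜ b = t}) ?_ ?_ ?_ ?_ hx
      · rintro _ ⟨a, b, hb, rfl⟩
        exact Submodule.subset_span ⟨c * a, d * b, K.mul_mem_left _ hb, by simp⟩
      · simp
      · intro x y _ _ hx hy
        rw [mul_add]; exact add_mem hx hy
      · intro e x _ hx
        rw [mul_smul_comm]; exact Submodule.smul_mem _ _ hx

lemma slice_mem_of_mem (φ : A →ₗ[k] k) {K : Ideal A} {t : A ⊗[k] A}
    (ht : t ∈ idealLeft (k := k) K) : slice φ t ∈ K := by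
  refine Submodule.span_induction (p := fun t _ => ∀ s, slice φ (s * t) ∈ K) ?_ ?_ ?_ ?_ ht 1 |>
    fun h => by simpa using h
  · rintro _ ⟨b, hb, rfl⟩ s
    have := slice_left_mul φ b s
    rw [mul_comm] at this
    exact (show slice φ (s * (b ⊗ₜ 1)) ∈ K from this ▸ K.mul_mem_right _ hb)
  · simp
  · intro x y _ _ hx hy s
    rw [mul_add, map_add]; exact add_mem (hx s) (hy s)
  · intro c x _ hx s
    rw [smul_eq_mul, ← _root_.mul_assoc]; exact hx _

/-- Since `evalRight ε ∘ Δ` is the identity, this makes `slice δ ∘ Δ` a derivation of `A`: the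
translation-invariant one extending the tangent vector `δ`. -/
lemma slice_mul_of_leibniz (ε : A →ₐ[k] k) (δ : A →ₗ[k] k)
    (hδ : ∀ a b, δ (a * b) = ε a * δ b + ε b * δ a) (s t : A ⊗[k] A) :
    slice δ (s * t) = evalRight ε s * slice δ t + evalRight ε t * slice δ s := by
  induction s with
  | zero => simp
  | add x y hx hy => simp only [add_mul, map_add, hx, hy, mul_add]; ring
  | tmul a b =>
    induction t with
    | zero => simp
    | add x y hx hy => simp only [mul_add, map_add, hx, hy, add_mul]; ring
    | tmul c d =>
      simp only [Algebra.TensorProduct.tmul_mul_tmul, slice_tmul, evalRight_tmul, hδ, add_smul,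
        smul_mul_smul_comm]
      rw [mul_comm c a]

end Slice

/-! ### Translation by Frobenius kernels. -/

section Bialgebra

open scoped TensorProduct

variable {k A : Type*} [Field k] [CommRing A] [Algebra k A] (p : ℕ) [Fact p.Prime] [CharP k p]
  (ε : A →ₐ[k] k) (Δ : A →ₐ[k] A ⊗[k] A)

lemma expChar_tensor [Nontrivial A] : ExpChar (A ⊗[k] A) p :=
  have : ExpChar k p := ExpChar.prime (Fact.out : p.Prime)
  expChar_of_injective_algebraMap (algebraMap k (A ⊗[k] A)).injective p

lemma comul_sub_left_mem (hr : ∀ a, evalRight ε (Δ a) = a) (a : A) :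
    Δ a - a ⊗ₜ 1 ∈ idealRight (k := k) (RingHom.ker ε) := by
  simpa [hr a] using sub_evalRight_mem ε (Δ a)

lemma comul_sub_right_mem (hl : ∀ a, evalLeft ε (Δ a) = a) (a : A) :
    Δ a - 1 ⊗ₜ a ∈ idealLeft (k := k) (RingHom.ker ε) := by
  simpa [hl a] using sub_evalLeft_mem ε (Δ a)

/-- Evaluating the convolution operator `slice φ ∘ Δ` at the origin gives back `φ`, because `Δ a`
restricts to `a` on `{e} × G`. -/
lemma slice_comul_sub_mem (hl : ∀ a, evalLeft ε (Δ a) = a) (φ : A →ₗ[k] k) (a : A) :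
    slice φ (Δ a) - algebraMap k A (φ a) ∈ RingHom.ker ε := by
  have := slice_mem_of_mem φ (comul_sub_right_mem ε Δ hl a)
  rwa [map_sub, slice_tmul, ← Algebra.algebraMap_eq_smul_one] at this

/-- Frobenius kernels are closed under multiplication: `Δ b` is `b ⊗ 1` plus an element of `A ⊗ I`,
and `q`-th powers are additive, so `Δ` maps `I^[q]` into `I^[q] ⊗ A + A ⊗ I^[q]`. The functional
kills the second summand. -/
lemma slice_comul_mem_frobIdeal [Nontrivial A] (hr : ∀ a, evalRight ε (Δ a) = a) (N : ℕ)
    (φ : A →ₗ[k] k) (hφ : ∀ a ∈ frobIdeal (RingHom.ker ε) (p ^ N), φ a = 0) {a : A}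
    (ha : a ∈ frobIdeal (RingHom.ker ε) (p ^ N)) :
    slice φ (Δ a) ∈ frobIdeal (RingHom.ker ε) (p ^ N) := by
  have := expChar_tensor (k := k) (A := A) p
  have h : frobIdeal (RingHom.ker ε) (p ^ N) ≤
      (idealLeft (k := k) (frobIdeal (RingHom.ker ε) (p ^ N)) ⊔
        idealRight (k := k) (frobIdeal (RingHom.ker ε) (p ^ N))).comap Δ := by
    refine frobIdeal_le.2 fun b hb => ?_
    rw [Ideal.mem_comap, map_pow, ← sub_add_cancel (Δ b) (b ⊗ₜ 1), add_pow_expChar_pow, add_comm]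
    exact Submodule.add_mem_sup
      (pow_mem_map_frobIdeal p _ N (Ideal.mem_map_of_mem
        (Algebra.TensorProduct.includeLeft (R := k) (S := k) (A := A) (B := A)).toRingHom hb))
      (pow_mem_map_frobIdeal p _ N (comul_sub_left_mem ε Δ hr b))
  obtain ⟨s, hs, t, ht, hst⟩ := Submodule.mem_sup.1 (h ha)
  rw [← hst, map_add, slice_eq_zero_of_mem φ hφ ht, add_zero]
  exact slice_mem_of_mem φ hs

/-- A `p ^ j`-th power which is killed modulo the `N`-th Frobenius kernel by an element that is
non-zero on the `j`-th Frobenius kernel vanishes on the `N`-th Frobenius kernel. -/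
lemma pow_mem_frobIdeal_of_pow_mul_mem [Nontrivial A] (hl : ∀ a, evalLeft ε (Δ a) = a)
    (hr : ∀ a, evalRight ε (Δ a) = a) (hnil : ∀ a ∈ RingHom.ker ε, IsNilpotent a)
    {j N : ℕ} (hjN : j ≤ N) {a y : A} (hy : y ∉ frobIdeal (RingHom.ker ε) (p ^ j))
    (hay : a ^ p ^ j * y ∈ frobIdeal (RingHom.ker ε) (p ^ N)) :
    a ^ p ^ j ∈ frobIdeal (RingHom.ker ε) (p ^ N) := by
  have := expChar_tensor (k := k) (A := A) p
  -- A functional supported on `G[F^j]` that detects `y`.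
  obtain ⟨φ, hφy, hφ⟩ := Submodule.exists_le_ker_of_notMem
    (p := (frobIdeal (RingHom.ker ε) (p ^ j)).restrictScalars k) hy
  have hφK : ∀ b ∈ frobIdeal (RingHom.ker ε) (p ^ j), φ b = 0 := fun b hb => hφ hb
  have hmem := slice_comul_mem_frobIdeal p ε Δ hr N φ (fun b hb => hφK b
    (frobIdeal_antitone _ (Fact.out : p.Prime).ne_zero hjN hb)) hay
  -- Non-zero constant `φ y` plus a nilpotent element.
  have hu : IsUnit (slice φ (Δ y)) := by
    have h1 := hnil _ (slice_comul_sub_mem ε Δ hl φ y)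
    have h2 : IsUnit (algebraMap k A (φ y)) := (IsUnit.mk0 _ hφy).map _
    simpa using h1.isUnit_add_left_of_commute h2 (Commute.all _ _)
  have hpow : Δ a ^ p ^ j - (a ^ p ^ j) ⊗ₜ 1 ∈
      idealRight (k := k) (frobIdeal (RingHom.ker ε) (p ^ j)) := by
    have := pow_mem_map_frobIdeal p _ j (comul_sub_left_mem ε Δ hr a)
    rwa [sub_pow_expChar_pow, Algebra.TensorProduct.tmul_pow, one_pow] at this
  -- Translation by points of `G[F^j]` fixes `p^j`-th powers, so `slice φ ∘ Δ` is linear over them.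
  have key : slice φ (Δ (a ^ p ^ j * y)) = a ^ p ^ j * slice φ (Δ y) := by
    rw [← slice_left_mul, ← sub_eq_zero, ← map_sub, map_mul, map_pow, ← sub_mul]
    exact slice_eq_zero_of_mem φ hφK (Ideal.mul_mem_right _ _ hpow)
  rw [key] at hmem
  exact (Ideal.mul_unit_mem_iff_mem _ hu).1 hmem

end Bialgebra

/-! ### Monomials in cotangent coordinates over a field. -/

section Monomials

open scoped TensorProduct

variable {k A : Type*} [Field k] [CommRing A] [Algebra k A] (p : ℕ) [Fact p.Prime] [CharP k p]
  (ε : A →ₐ[k] k) (Δ : A →ₐ[k] A ⊗[k] A) {r : ℕ} (x : Fin r → A)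

/-- The monomial `∏ x_i ^ (α_i)`. -/
def monom {A : Type*} [CommRing A] {r : ℕ} (x : Fin r → A) (α : Fin r → ℕ) : A := ∏ i, x i ^ α i

lemma monom_add {A : Type*} [CommRing A] {r : ℕ} (x : Fin r → A) (α β : Fin r → ℕ) :
    monom x (α + β) = monom x α * monom x β := by
  simp [monom, pow_add, Finset.prod_mul_distrib]

lemma monom_mul_const {A : Type*} [CommRing A] {r : ℕ} (x : Fin r → A) (a b : ℕ) :
    monom x (fun _ => a * b) = monom x (fun _ => b) ^ a := by
  simp only [monom, ← Finset.prod_pow, ← pow_mul, mul_comm]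

lemma monom_single_mul {A : Type*} [CommRing A] {r : ℕ} (x : Fin r → A) (α : Fin r → ℕ) (i : Fin r) :
    monom x (α + Pi.single i 1) = monom x α * x i := by
  rw [monom_add]
  congr 1
  rw [monom, Finset.prod_eq_single i] <;> simp +contextual

lemma exists_eq_add_single {r : ℕ} {α : Fin r → ℕ} {i : Fin r} (hi : α i ≠ 0) :
    ∃ β : Fin r → ℕ, α = β + Pi.single i 1 := by
  refine ⟨fun j => α j - (Pi.single i 1 : Fin r → ℕ) j, funext fun j => ?_⟩
  rcases eq_or_ne j i with rfl | hj
  · simp only [Pi.add_apply, Pi.single_eq_same]; omega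
  · simp [hj]

/-- The `i`-th coordinate function on the span of the classes of the `x_j` is extended to `A / I^2`
and composed with the projection `a ↦ a - ε a` onto `I`; the Leibniz rule holds because products of
two elements of `I` die in `A / I^2`. -/
lemma exists_pointDerivation
    (hx : LinearIndependent k (fun i => Ideal.Quotient.mk (RingHom.ker ε ^ 2) (x i)))
    (hxI : ∀ i, ε (x i) = 0) (i : Fin r) :
    ∃ δ : A →ₗ[k] k, (∀ a b, δ (a * b) = ε a * δ b + ε b * δ a) ∧
      ∀ j, δ (x j) = if i = j then 1 else 0 := by
  obtain ⟨g, hg⟩ := LinearMap.exists_extend (Finsupp.lapply i ∘ₗ hx.repr)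
  let q : A →ₗ[k] A ⧸ (RingHom.ker ε ^ 2) := (Ideal.Quotient.mkₐ k (RingHom.ker ε ^ 2)).toLinearMap
  let P : A →ₗ[k] A := LinearMap.id - (Algebra.linearMap k A) ∘ₗ ε.toLinearMap
  have hP : ∀ a, P a = a - algebraMap k A (ε a) := fun a => rfl
  have hPI : ∀ a, P a ∈ RingHom.ker ε := fun a => by simp [hP, RingHom.mem_ker]
  refine ⟨g ∘ₗ q ∘ₗ P, fun a b => ?_, fun j => ?_⟩
  · have h : P (a * b) = P a * P b + (ε a • P b + ε b • P a) := by
      simp only [hP, map_mul, Algebra.smul_def]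
      ring
    have h0 : q (P a * P b) = 0 := by
      refine Ideal.Quotient.eq_zero_iff_mem.2 ?_
      rw [pow_two]
      exact Ideal.mul_mem_mul (hPI a) (hPI b)
    simp only [LinearMap.comp_apply, h, map_add, h0, map_smul, smul_eq_mul, zero_add]
  · have hPx : P (x j) = x j := by simp [hP, hxI]
    have hmem : q (x j) ∈ Submodule.span k
        (Set.range fun i => Ideal.Quotient.mk (RingHom.ker ε ^ 2) (x i)) :=
      Submodule.subset_span ⟨j, rfl⟩
    have h1 := LinearMap.congr_fun hg ⟨q (x j), hmem⟩
    have h2 : hx.repr ⟨q (x j), hmem⟩ = Finsupp.single j 1 := hx.repr_eq_single j _ rfl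
    simp only [LinearMap.comp_apply, Submodule.subtype_apply, hPx] at h1 ⊢
    rw [h1, h2]
    simp [Finsupp.single_apply, eq_comm]

/-- Induction on the degree `d`, lowering one exponent by an invariant derivation `D`. Such a `D`
kills `p`-th powers, hence preserves `I^[p]`, and sends `I^(d+2)` into `I^(d+1)`. The summand
`I^(d+1)` is there to absorb the error terms, since `D (x j)` is a Kronecker delta only modulo `I`.
-/
lemma monom_notMem_frobIdeal_one [Nontrivial A] (hl : ∀ a, evalLeft ε (Δ a) = a)
    (hr : ∀ a, evalRight ε (Δ a) = a)
    (hx : LinearIndependent k (fun i => Ideal.Quotient.mk (RingHom.ker ε ^ 2) (x i)))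
    (hxI : ∀ i, ε (x i) = 0) (d : ℕ) (α : Fin r → ℕ) (hα : ∀ i, α i < p) (hd : ∑ i, α i = d) :
    monom x α ∉ frobIdeal (RingHom.ker ε) p ⊔ RingHom.ker ε ^ (d + 1) := by
  have hxker : ∀ i, x i ∈ RingHom.ker ε := hxI
  have : CharP A p := charP_of_injective_algebraMap (algebraMap k A).injective p
  induction d generalizing α with
  | zero =>
    have hα0 : α = 0 := by
      funext i
      exact (Finset.sum_eq_zero_iff.1 hd) i (Finset.mem_univ i)
    rw [hα0]
    intro h
    have h1 : (monom x 0 : A) ∈ RingHom.ker ε := by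
      have hle : frobIdeal (RingHom.ker ε) p ⊔ RingHom.ker ε ^ (0 + 1) ≤ RingHom.ker ε :=
        sup_le (frobIdeal_le_self (Fact.out : p.Prime).ne_zero) (by simp)
      exact hle h
    simp [monom, RingHom.mem_ker] at h1
  | succ d ih =>
    obtain ⟨i, hi⟩ : ∃ i, α i ≠ 0 := by
      by_contra! h
      simp [h] at hd
    obtain ⟨β, rfl⟩ := exists_eq_add_single hi
    have hβd : ∑ j, β j = d := by
      simpa [Finset.sum_add_distrib] using hd
    have hβp : ∀ j, β j < p := fun j => lt_of_le_of_lt (by simp) (hα j)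
    obtain ⟨δ, hδ, hδx⟩ := exists_pointDerivation ε x hx hxI i
    set D : A →ₗ[k] A := slice δ ∘ₗ Δ.toLinearMap with hD
    have hDmul : ∀ a b, D (a * b) = a * D b + b * D a := fun a b => by
      simp [hD, slice_mul_of_leibniz ε δ hδ, hr]
    have hDpow : ∀ a (N : ℕ), D (a ^ (N + 1)) = ((N + 1 : ℕ) : A) * a ^ N * D a := fun a N => by
      induction N with
      | zero => simp
      | succ N ihN => rw [pow_succ, hDmul, ihN]; push_cast; ring
    have hDI : ∀ N, ∀ a ∈ RingHom.ker ε ^ (N + 1), D a ∈ RingHom.ker ε ^ N := fun N a ha => by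
      induction N generalizing a with
      | zero => simp
      | succ N ihN =>
        rw [pow_succ] at ha
        refine Submodule.mul_induction_on ha (fun a ha b hb => ?_) (fun a b ha hb => ?_)
        · rw [hDmul]
          refine add_mem (Ideal.mul_mem_right _ _ ha) ?_
          rw [pow_succ, mul_comm b]
          exact Ideal.mul_mem_mul (ihN a ha) hb
        · rw [map_add]; exact add_mem ha hb
    have hDK : ∀ a ∈ frobIdeal (RingHom.ker ε) p, D a ∈ frobIdeal (RingHom.ker ε) p := by
      intro a ha
      refine Submodule.span_induction (p := fun a _ => D a ∈ frobIdeal (RingHom.ker ε) p)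
        ?_ ?_ ?_ ?_ ha
      · rintro _ ⟨b, hb, rfl⟩
        have := hDpow b (p - 1)
        rw [Nat.sub_add_cancel (Fact.out : p.Prime).one_le, CharP.cast_eq_zero] at this
        simp [this]
      · simp
      · intro a b _ _ ha hb
        rw [map_add]; exact add_mem ha hb
      · intro c a h ha
        rw [smul_eq_mul, hDmul]
        exact add_mem (Ideal.mul_mem_left _ _ ha) (Ideal.mul_mem_right _ _ h)
    have hDx : ∀ j, D (x j) - (if i = j then 1 else 0) ∈ RingHom.ker ε := fun j => by
      have := slice_comul_sub_mem ε Δ hl δ (x j)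
      rw [hδx, apply_ite (algebraMap k A), map_one, map_zero] at this
      exact this
    have hmon : ∀ (N : ℕ) (c : Fin r → ℕ), ∑ j, c j = N → monom x c ∈ RingHom.ker ε ^ N := by
      rintro _ c rfl
      rw [monom, ← Finset.prod_pow_eq_pow_sum]
      exact Ideal.prod_mem_prod fun j _ => Ideal.pow_mem_pow (hxker j) _
    have hDmon : ∀ (N : ℕ) (c : Fin r → ℕ), ∑ j, c j = N →
        D (monom x (c + Pi.single i 1)) - ((c i + 1 : ℕ) : A) * monom x c ∈
          RingHom.ker ε ^ (N + 1) := by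
      intro N
      induction N with
      | zero =>
        intro c hc
        have hc0 : c = 0 := funext fun j => (Finset.sum_eq_zero_iff.1 hc) j (Finset.mem_univ j)
        have := hDx i
        subst hc0
        rw [monom_single_mul]
        simpa [monom] using this
      | succ N ihN =>
        intro c hc
        obtain ⟨j, hj⟩ : ∃ j, c j ≠ 0 := by
          by_contra! h
          simp [h] at hc
        obtain ⟨e, rfl⟩ := exists_eq_add_single hj
        have heN : ∑ l, e l = N := by simpa [Finset.sum_add_distrib] using hc
        have h1 := Ideal.mul_mem_mul (ihN e heN) (hxker j)
        have h2 := Ideal.mul_mem_mul (hmon (N + 1) (e + Pi.single i 1)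
          (by simp [Finset.sum_add_distrib, heN])) (hDx j)
        rw [← pow_succ] at h1 h2
        rw [add_right_comm e, monom_single_mul x (e + Pi.single i 1) j, hDmul]
        convert add_mem h1 h2 using 1
        generalize D (monom x (e + Pi.single i 1)) = d
        rcases eq_or_ne i j with rfl | hij
        · simp only [monom_single_mul, if_true, Pi.add_apply, Pi.single_eq_same]
          push_cast
          ring
        · simp only [monom_single_mul, if_neg hij, Pi.add_apply, Pi.single_eq_of_ne hij]
          push_cast
          ring
    intro hmem
    refine ih β hβp hβd ?_
    have hDmem : D (monom x (β + Pi.single i 1)) ∈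
        frobIdeal (RingHom.ker ε) p ⊔ RingHom.ker ε ^ (d + 1) := by
      obtain ⟨a, ha, b, hb, hab⟩ := Submodule.mem_sup.1 hmem
      rw [← hab, map_add]
      exact Submodule.add_mem_sup (hDK a ha) (hDI _ b hb)
    -- The factor produced by differentiating is an exponent between `1` and `p - 1`.
    have hu : IsUnit ((β i + 1 : ℕ) : A) := by
      rw [← map_natCast (algebraMap k A)]
      refine (IsUnit.mk0 _ fun h => ?_).map _
      have h1 := (CharP.cast_eq_zero_iff k p _).1 h
      have h2 := hα i
      simp only [Pi.add_apply, Pi.single_eq_same] at h2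
      exact Nat.not_dvd_of_pos_of_lt (by omega) h2 h1
    have h3 := sub_mem hDmem (Ideal.mem_sup_right (hDmon d β hβd) :
      _ ∈ frobIdeal (RingHom.ker ε) p ⊔ RingHom.ker ε ^ (d + 1))
    rw [sub_sub_cancel] at h3
    exact (Ideal.unit_mul_mem_iff_mem _ hu).1 h3

/-- The product of the `(p ^ n - 1)`-st powers of coordinates at the origin is non-zero on the
`n`-th Frobenius kernel, provided that `F^m` maps the `(m + l)`-th Frobenius kernel onto the
`l`-th Frobenius kernel of the twist for all `l ≤ n - m`. -/
lemma monom_notMem_frobIdeal [Nontrivial A] (hl : ∀ a, evalLeft ε (Δ a) = a)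
    (hr : ∀ a, evalRight ε (Δ a) = a) (hnil : ∀ a ∈ RingHom.ker ε, IsNilpotent a)
    (hx : LinearIndependent k (fun i => Ideal.Quotient.mk (RingHom.ker ε ^ 2) (x i)))
    (hxI : ∀ i, ε (x i) = 0) {m n : ℕ} (hm : 1 ≤ m) (hmn : m < n)
    (hfrob : ∀ l ≤ n - m, ∀ a, a ^ p ^ m ∈ frobIdeal (RingHom.ker ε) (p ^ (m + l)) →
      a ∈ frobIdeal (RingHom.ker ε) (p ^ l)) (j : ℕ) (hj : j ≤ n) :
    monom x (fun _ => p ^ j - 1) ∉ frobIdeal (RingHom.ker ε) (p ^ j) := by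
  have hp : p.Prime := Fact.out
  have h0 : monom x (fun _ => p ^ 0 - 1) ∉ frobIdeal (RingHom.ker ε) (p ^ 0) := by
    intro h
    have := frobIdeal_le_self (by simp) h
    simp [monom, RingHom.mem_ker] at this
  have h1 : monom x (fun _ => p ^ 1 - 1) ∉ frobIdeal (RingHom.ker ε) (p ^ 1) := by
    rw [pow_one]
    exact fun h => monom_notMem_frobIdeal_one p ε Δ x hl hr hx hxI _ _
      (fun _ => Nat.sub_lt hp.pos one_pos) rfl (Ideal.mem_sup_left h)
  -- Cancellation applied to `p^(i+l) - 1 = p^i (p^l - 1) + (p^i - 1)`.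
  have hstep : ∀ i l, monom x (fun _ => p ^ i - 1) ∉ frobIdeal (RingHom.ker ε) (p ^ i) →
      monom x (fun _ => p ^ l - 1) ^ p ^ i ∉ frobIdeal (RingHom.ker ε) (p ^ (i + l)) →
      monom x (fun _ => p ^ (i + l) - 1) ∉ frobIdeal (RingHom.ker ε) (p ^ (i + l)) := by
    intro i l hi hil h
    refine hil (pow_mem_frobIdeal_of_pow_mul_mem p ε Δ hl hr hnil (Nat.le_add_right i l) hi ?_)
    rw [← monom_mul_const, ← monom_add]
    convert h using 2
    funext _
    have h1 := Nat.one_le_pow i p hp.pos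
    have h2 := Nat.one_le_pow l p hp.pos
    simp only [Pi.add_apply, pow_add, Nat.mul_sub, _root_.mul_one]
    have := Nat.le_mul_of_pos_right (p ^ i) h2
    omega
  -- Raising a membership to the power `p^(m-i)` brings it to the exponent `p^m`, where `hfrob` with
  -- `l = 1` applies; `1 ≤ n - m` because `m < n`.
  have hsmall : ∀ i, i ≤ m → monom x (fun _ => p ^ 1 - 1) ^ p ^ i ∉
      frobIdeal (RingHom.ker ε) (p ^ (i + 1)) := by
    intro i hi h
    have hc : ExpChar A p :=
      have : ExpChar k p := ExpChar.prime hp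
      expChar_of_injective_algebraMap (algebraMap k A).injective p
    refine h1 (hfrob 1 (by omega) _ ?_)
    obtain ⟨c, rfl⟩ := Nat.exists_eq_add_of_le hi
    rw [pow_add p i c, pow_mul]
    have h2 : (monom x (fun _ => p ^ 1 - 1) ^ p ^ i) ^ p ^ c ∈
        frobIdeal (frobIdeal (RingHom.ker ε) (p ^ (i + 1))) (p ^ c) := pow_mem_frobIdeal h _
    refine frobIdeal_le.2 ?_ h2
    intro a ha
    refine Submodule.span_induction (p := fun a _ => a ^ p ^ c ∈
      frobIdeal (RingHom.ker ε) (p ^ (i + c + 1))) ?_ ?_ ?_ ?_ ha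
    · rintro _ ⟨b, hb, rfl⟩
      simp only
      rw [← pow_mul, ← pow_add, add_right_comm]
      exact pow_mem_frobIdeal hb _
    · rw [zero_pow (pow_ne_zero _ hp.ne_zero)]; exact zero_mem _
    · intro a b _ _ ha hb
      rw [add_pow_expChar_pow]; exact add_mem ha hb
    · intro b a _ ha
      rw [smul_eq_mul, mul_pow]; exact Ideal.mul_mem_left _ _ ha
  have hle : ∀ i ≤ m, monom x (fun _ => p ^ i - 1) ∉ frobIdeal (RingHom.ker ε) (p ^ i) := by
    intro i
    induction i with
    | zero => exact fun _ => h0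
    | succ i ih => exact fun hi => hstep i 1 (ih (by omega)) (hsmall i (by omega))
  -- Beyond `m`, write `j = m + l`: `hfrob` reduces to `l`, which is smaller than `j` because `1 ≤
  -- m`.
  induction j using Nat.strong_induction_on with
  | _ j ih =>
    rcases le_or_gt j m with hjm | hjm
    · exact hle j hjm
    · obtain ⟨l, rfl⟩ := Nat.exists_eq_add_of_le hjm.le
      exact hstep m l (hle m le_rfl) fun h => ih l (by omega) (by omega)
        (hfrob l (by omega) _ h)

/-- In a relation, take a monomial of least total degree with non-zero coefficient and multiply by
its complement in the top monomial. Every other term acquires some `x_i` to a power at least `N`, so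
only the top monomial survives. -/
lemma linearIndependent_monom {N : ℕ} (hxN : ∀ i, x i ^ N = 0)
    (htop : monom x (fun _ => N - 1) ≠ 0) :
    LinearIndependent k (fun α : Fin r → Fin N => monom x (fun i => (α i : ℕ))) := by
  rw [Fintype.linearIndependent_iff]
  intro c hc
  classical
  by_contra! hne
  obtain ⟨α, hα, hmin⟩ := Finset.exists_min_image ({α | c α ≠ 0} : Finset _)
    (fun α => ∑ i, (α i : ℕ)) (by simpa [Finset.Nonempty] using hne)
  have hα0 : c α ≠ 0 := by simpa using hα
  have h := congrArg (· * monom x (fun i => N - 1 - α i)) hc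
  simp only [Finset.sum_mul, zero_mul] at h
  rw [Finset.sum_eq_single α] at h
  · rw [smul_mul_assoc, ← monom_add] at h
    have h2 : ((fun i => (α i : ℕ)) + fun i => N - 1 - α i) = fun _ => N - 1 := by
      funext i
      have := (α i).2
      simp only [Pi.add_apply]
      omega
    rw [h2] at h
    exact htop ((smul_eq_zero_iff_right hα0).1 h)
  · intro β _ hβ
    rcases eq_or_ne (c β) 0 with h0 | h0
    · simp [h0]
    · obtain ⟨i, hi⟩ : ∃ i, (α i : ℕ) < β i := by
        by_contra! hle
        have h1 := hmin β (by simpa using h0)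
        have h2 := Finset.sum_le_sum (s := Finset.univ) fun i _ => hle i
        have h3 := (Finset.sum_eq_sum_iff_of_le fun i _ => hle i).1 (le_antisymm h2 h1)
        exact hβ (funext fun i => Fin.ext (h3 i (Finset.mem_univ i)))
      rw [smul_mul_assoc, ← monom_add, monom, ← Finset.prod_erase_mul _ _ (Finset.mem_univ i)]
      have h4 : x i ^ ((fun i => (β i : ℕ)) + fun i => N - 1 - (α i : ℕ) : Fin r → ℕ) i = 0 := by
        refine pow_eq_zero_of_le ?_ (hxN i)
        have := (α i).2
        simp only [Pi.add_apply]
        omega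
      rw [h4, mul_zero, smul_zero]
  · simp

/-- Nilpotent Nakayama: generators of `I / I^2` generate `I`, and successive approximation modulo
powers of `I` ends after finitely many steps. -/
lemma span_monom_eq_top (hnil : IsNilpotent (RingHom.ker ε)) (hxI : ∀ i, ε (x i) = 0)
    (hspan : ∀ a ∈ RingHom.ker ε, ∃ c : Fin r → k,
      a - ∑ i, c i • x i ∈ RingHom.ker ε ^ 2) {N : ℕ} (hN : N ≠ 0) (hxN : ∀ i, x i ^ N = 0) :
    Submodule.span k (Set.range fun α : Fin r → Fin N => monom x (fun i => (α i : ℕ))) = ⊤ := by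
  set W := Submodule.span k (Set.range fun α : Fin r → Fin N => monom x (fun i => (α i : ℕ)))
  obtain ⟨M, hM⟩ := hnil
  set V : Ideal A := Ideal.span (Set.range x)
  have hIV : ∀ j, RingHom.ker ε ≤ V ⊔ RingHom.ker ε ^ (j + 1) := by
    have h2 : RingHom.ker ε ≤ V ⊔ RingHom.ker ε * RingHom.ker ε := by
      intro a ha
      obtain ⟨c, hc⟩ := hspan a ha
      rw [pow_two] at hc
      rw [← sub_add_cancel a (∑ i, c i • x i), add_comm]
      refine Submodule.add_mem_sup (Submodule.sum_mem _ fun i _ => ?_) hc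
      rw [Algebra.smul_def]
      exact Ideal.mul_mem_left _ _ (Ideal.subset_span ⟨i, rfl⟩)
    intro j
    induction j with
    | zero => simp
    | succ j ih =>
      refine h2.trans (sup_le le_sup_left ?_)
      refine (Ideal.mul_mono_right ih).trans ?_
      rw [Ideal.mul_sup, ← pow_succ']
      exact sup_le_sup_right Ideal.mul_le_right _
  have hIV' : RingHom.ker ε ≤ V := by
    have := hIV M
    rw [pow_succ, hM, zero_mul] at this
    simpa using this
  have hone : (1 : A) ∈ W :=
    Submodule.subset_span ⟨fun _ => ⟨0, Nat.pos_of_ne_zero hN⟩, by simp [monom]⟩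
  have hmul : ∀ i, ∀ w ∈ W, w * x i ∈ W := by
    intro i w hw
    refine Submodule.span_induction (p := fun w _ => w * x i ∈ W) ?_ ?_ ?_ ?_ hw
    · rintro _ ⟨α, rfl⟩
      simp only
      rw [← monom_single_mul]
      by_cases hi : (α i : ℕ) + 1 < N
      · refine Submodule.subset_span ⟨Function.update α i ⟨α i + 1, hi⟩, ?_⟩
        simp only
        congr 1
        funext j
        rcases eq_or_ne j i with rfl | hj <;> simp [*]
      · rw [monom, ← Finset.prod_erase_mul _ _ (Finset.mem_univ i)]
        have h4 : x i ^ ((fun i => (α i : ℕ)) + Pi.single i 1 : Fin r → ℕ) i = 0 := by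
          refine pow_eq_zero_of_le ?_ (hxN i)
          simp only [Pi.add_apply, Pi.single_eq_same]
          omega
        rw [h4, mul_zero]
        exact zero_mem _
    · rw [zero_mul]; exact zero_mem _
    · intro a b _ _ ha hb
      rw [add_mul]; exact add_mem ha hb
    · intro c a _ ha
      rw [smul_mul_assoc]; exact Submodule.smul_mem _ _ ha
  have key : ∀ j, ∀ a : A, ∃ w ∈ W, a - w ∈ RingHom.ker ε ^ j := by
    intro j
    induction j with
    | zero => exact fun a => ⟨0, zero_mem _, by simp⟩
    | succ j ih =>
      intro a
      have ha : a - algebraMap k A (ε a) ∈ V := hIV' (by simp [RingHom.mem_ker])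
      obtain ⟨b, hb⟩ := (Ideal.mem_span_range_iff_exists_fun).1 ha
      choose w hw hbw using fun i => ih (b i)
      refine ⟨algebraMap k A (ε a) + ∑ i, w i * x i, add_mem ?_
        (Submodule.sum_mem _ fun i _ => hmul i _ (hw i)), ?_⟩
      · rw [Algebra.algebraMap_eq_smul_one]
        exact Submodule.smul_mem _ _ hone
      · rw [← sub_sub, ← hb, ← Finset.sum_sub_distrib]
        refine Submodule.sum_mem _ fun i _ => ?_
        rw [← sub_mul, pow_succ]
        exact Ideal.mul_mem_mul (hbw i) (hxI i)
  rw [eq_top_iff]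
  intro a _
  obtain ⟨w, hw, haw⟩ := key M a
  rw [hM, Ideal.zero_eq_bot, Ideal.mem_bot, sub_eq_zero] at haw
  exact haw ▸ hw

end Monomials

/-! ### Spreading a basis from a fibre to a neighbourhood. -/

section Spreading

open scoped TensorProduct

variable {R : Type*} [CommRing R] {M : Type*} [AddCommGroup M] [Module R M] {J : Type*}

lemma isLocalizedModule_map_linearCombination (S : Submonoid R) (R' : Type*) [CommRing R']
    [Algebra R R'] [IsLocalization S R'] {M' : Type*} [AddCommGroup M'] [Module R M'] [Module R' M']
    [IsScalarTower R R' M'] (g : M →ₗ[R] M') [IsLocalizedModule S g] (v : J → M) :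
    IsLocalizedModule.map S (Finsupp.mapRange.linearMap (α := J) (Algebra.linearMap R R')) g
      (Finsupp.linearCombination R v) =
      (Finsupp.linearCombination R' (g ∘ v)).restrictScalars R := by
  refine IsLocalizedModule.linearMap_ext S
    (Finsupp.mapRange.linearMap (α := J) (Algebra.linearMap R R')) g ?_
  rw [IsLocalizedModule.map_comp]
  ext i
  simp

/-- A finite family in a finitely presented flat module which is a basis of the fibre at a prime
is a basis after inverting an element outside the prime. -/
lemma exists_notMem_basis_away [Finite J] [Module.FinitePresentation R M] [Module.Flat R M]
    (v : J → M) (P : Ideal R) [P.IsPrime] (K : Type*) [Field K] [Algebra R K]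
    [Algebra P.ResidueField K] [IsScalarTower R P.ResidueField K]
    (hli : LinearIndependent K (fun i => (1 : K) ⊗ₜ[R] v i))
    (hsp : Submodule.span K (Set.range fun i => (1 : K) ⊗ₜ[R] v i) = ⊤) :
    ∃ f ∉ P, ∀ (R' : Type u) [CommRing R'] [Algebra R R'] [IsLocalization.Away f R']
      (M' : Type u) [AddCommGroup M'] [Module R M'] [Module R' M'] [IsScalarTower R R' M']
      (g : M →ₗ[R] M') [IsLocalizedModule (Submonoid.powers f) g],
      LinearIndependent R' (g ∘ v) ∧ Submodule.span R' (Set.range (g ∘ v)) = ⊤ := by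
  have := Fintype.ofFinite J
  let κ := P.ResidueField
  have hliκ : LinearIndependent κ (fun i => (1 : κ) ⊗ₜ[R] v i) := by
    let φ : κ ⊗[R] M →ₗ[κ] K ⊗[R] M :=
      TensorProduct.AlgebraTensorModule.map (Algebra.linearMap κ K) LinearMap.id
    refine LinearIndependent.of_comp φ ?_
    have h : φ ∘ (fun i => (1 : κ) ⊗ₜ[R] v i) = fun i => (1 : K) ⊗ₜ[R] v i := by
      funext i
      simp [φ]
    rw [h]
    exact hli.restrict_scalars' κ
  -- Spanning descends from `K` to the residue field by counting dimensions.
  have hspκ : Submodule.span κ (Set.range fun i => (1 : κ) ⊗ₜ[R] v i) = ⊤ := by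
    refine hliκ.span_eq_top_of_card_eq_finrank' ?_
    have h1 : Fintype.card J = Module.finrank K (K ⊗[R] M) :=
      (Module.finrank_eq_card_basis (Module.Basis.mk hli hsp.ge)).symm
    rw [h1, ← (TensorProduct.AlgebraTensorModule.cancelBaseChange R κ K K M).finrank_eq,
      Module.finrank_baseChange]
  let R₀ := Localization.AtPrime P
  let M₀ := R₀ ⊗[R] M
  let g₀ : M →ₗ[R] M₀ := TensorProduct.mk R R₀ M 1
  let e : κ ⊗[R₀] M₀ ≃ₗ[κ] κ ⊗[R] M :=
    TensorProduct.AlgebraTensorModule.cancelBaseChange R R₀ κ κ M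
  have he : ∀ i, e ((TensorProduct.mk R₀ κ M₀ 1 ∘ (g₀ ∘ v)) i) = (1 : κ) ⊗ₜ[R] v i := by
    intro i
    change TensorProduct.AlgebraTensorModule.cancelBaseChange R R₀ κ κ M
      ((1 : κ) ⊗ₜ[R₀] ((1 : R₀) ⊗ₜ[R] v i)) = _
    rw [TensorProduct.AlgebraTensorModule.cancelBaseChange_tmul, one_smul]
  have he' : e.toLinearMap ∘ (TensorProduct.mk R₀ κ M₀ 1 ∘ (g₀ ∘ v)) =
      fun i => (1 : κ) ⊗ₜ[R] v i := funext he
  -- Nakayama over the local ring; independence lifts because flatness makes `𝔪 ⊗ M₀ → M₀`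
  -- injective.
  obtain ⟨b, hb⟩ := Module.exists_basis_of_basis_baseChange (R := R₀) (M := M₀) (g₀ ∘ v)
    (LinearIndependent.of_comp e.toLinearMap (he' ▸ hliκ)) (by
      apply Submodule.map_injective_of_injective e.injective
      have := Submodule.map_span e.toLinearMap (Set.range (TensorProduct.mk R₀ κ M₀ 1 ∘ (g₀ ∘ v)))
      rw [← Set.range_comp, he', hspκ] at this
      have htop : Submodule.map e.toLinearMap ⊤ = ⊤ := by
        rw [Submodule.map_top, LinearEquiv.range]
      exact this.trans htop.symm)
    (Module.Flat.rTensor_preserves_injective_linearMap _ Subtype.val_injective)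
  have hbv : ⇑b = g₀ ∘ v := funext hb
  have hbij : Function.Bijective (IsLocalizedModule.map P.primeCompl
      (Finsupp.mapRange.linearMap (α := J) (Algebra.linearMap R R₀)) g₀
      (Finsupp.linearCombination R v)) := by
    rw [isLocalizedModule_map_linearCombination P.primeCompl R₀ g₀ v, ← hbv]
    constructor
    · exact b.linearIndependent
    · exact (LinearMap.range_eq_top (f := Finsupp.linearCombination R₀ b)).1
        (by rw [Finsupp.range_linearCombination, b.span_eq])
  -- A map of finitely presented modules that is bijective at `P` is bijective after inverting one
  -- `f ∉ P`.
  obtain ⟨f, hfP, hf⟩ := Module.FinitePresentation.exists_notMem_bijective _ P _ _ hbij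
  refine ⟨f, hfP, ?_⟩
  intro R' _ _ _ M' _ _ _ _ g _
  rw [← IsLocalizedModule.map_bijective_iff_localizedModuleMap_bijective
    (Finsupp.mapRange.linearMap (α := J) (Algebra.linearMap R R')) g,
    isLocalizedModule_map_linearCombination _ R' g v] at hf
  refine ⟨hf.1, ?_⟩
  rw [← Finsupp.range_linearCombination]
  exact LinearMap.range_eq_top.2 hf.2

end Spreading

/-! ### The fibre Hopf data and the local basis of monomials. -/

section BaseChange

open scoped TensorProduct

variable {R A : Type u} [CommRing R] [CommRing A] [Algebra R A] (k : Type u) [Field k] [Algebra R k]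

/-- The base change `k ⊗ A → k` of an augmentation `A → R`. -/
def baseCounit (ε : A →ₐ[R] R) : k ⊗[R] A →ₐ[k] k :=
  Algebra.TensorProduct.lift (AlgHom.id k k) ((Algebra.ofId R k).comp ε) fun _ _ => .all _ _

@[simp] lemma baseCounit_tmul (ε : A →ₐ[R] R) (c : k) (a : A) :
    baseCounit k ε (c ⊗ₜ a) = c * algebraMap R k (ε a) := by
  simp [baseCounit, Algebra.ofId_apply]

/-- The canonical map `A ⊗ A → (k ⊗ A) ⊗ (k ⊗ A)`. -/
def tensorToBase : A ⊗[R] A →ₐ[R] (k ⊗[R] A) ⊗[k] (k ⊗[R] A) :=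
  Algebra.TensorProduct.lift
    (((Algebra.TensorProduct.includeLeft (R := k) (S := k) (A := k ⊗[R] A)
      (B := k ⊗[R] A)).restrictScalars R).comp Algebra.TensorProduct.includeRight)
    (((Algebra.TensorProduct.includeRight (R := k) (A := k ⊗[R] A)
      (B := k ⊗[R] A)).restrictScalars R).comp Algebra.TensorProduct.includeRight)
    fun _ _ => .all _ _

@[simp] lemma tensorToBase_tmul (a b : A) :
    tensorToBase k (a ⊗ₜ[R] b) = ((1 : k) ⊗ₜ[R] a) ⊗ₜ[k] ((1 : k) ⊗ₜ[R] b) := by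
  simp [tensorToBase]

/-- The base change of a comultiplication. -/
def baseComul (Δ : A →ₐ[R] A ⊗[R] A) : k ⊗[R] A →ₐ[k] (k ⊗[R] A) ⊗[k] (k ⊗[R] A) :=
  Algebra.TensorProduct.lift (Algebra.ofId k _) ((tensorToBase k).comp Δ) fun _ _ => .all _ _

@[simp] lemma baseComul_tmul (Δ : A →ₐ[R] A ⊗[R] A) (c : k) (a : A) :
    baseComul k Δ (c ⊗ₜ a) = c • tensorToBase k (Δ a) := by
  rw [baseComul, Algebra.TensorProduct.lift_tmul, Algebra.ofId_apply, ← Algebra.smul_def]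
  rfl

lemma evalRight_baseComul (ε : A →ₐ[R] R) (Δ : A →ₐ[R] A ⊗[R] A)
    (hr : ∀ a, Algebra.TensorProduct.lift (AlgHom.id R A) ((Algebra.ofId R A).comp ε)
      (fun _ _ => .all _ _) (Δ a) = a) (b : k ⊗[R] A) :
    evalRight (baseCounit k ε) (baseComul k Δ b) = b := by
  induction b with
  | zero => simp
  | add x y hx hy => rw [map_add, map_add, hx, hy]
  | tmul c a =>
    have key : ∀ t : A ⊗[R] A, evalRight (baseCounit k ε) (tensorToBase k t) =
        (1 : k) ⊗ₜ[R] (Algebra.TensorProduct.lift (AlgHom.id R A) ((Algebra.ofId R A).comp ε)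
          (fun _ _ => .all _ _) t) := by
      intro t
      induction t with
      | zero => simp
      | add x y hx hy => rw [map_add, map_add, hx, hy, map_add, TensorProduct.tmul_add]
      | tmul a b =>
        simp only [tensorToBase_tmul, evalRight_tmul, baseCounit_tmul, _root_.one_mul,
          Algebra.TensorProduct.lift_tmul, AlgHom.id_apply, AlgHom.comp_apply, Algebra.ofId_apply]
        rw [mul_comm a, ← Algebra.smul_def, TensorProduct.tmul_smul, algebraMap_smul]
    rw [baseComul_tmul, map_smul, key, hr, TensorProduct.smul_tmul', smul_eq_mul, _root_.mul_one]

lemma evalLeft_baseComul (ε : A →ₐ[R] R) (Δ : A →ₐ[R] A ⊗[R] A)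
    (hl : ∀ a, Algebra.TensorProduct.lift ((Algebra.ofId R A).comp ε) (AlgHom.id R A)
      (fun _ _ => .all _ _) (Δ a) = a) (b : k ⊗[R] A) :
    evalLeft (baseCounit k ε) (baseComul k Δ b) = b := by
  induction b with
  | zero => simp
  | add x y hx hy => rw [map_add, map_add, hx, hy]
  | tmul c a =>
    have key : ∀ t : A ⊗[R] A, evalLeft (baseCounit k ε) (tensorToBase k t) =
        (1 : k) ⊗ₜ[R] (Algebra.TensorProduct.lift ((Algebra.ofId R A).comp ε) (AlgHom.id R A)
          (fun _ _ => .all _ _) t) := by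
      intro t
      induction t with
      | zero => simp
      | add x y hx hy => rw [map_add, map_add, hx, hy, map_add, TensorProduct.tmul_add]
      | tmul a b =>
        simp only [tensorToBase_tmul, evalLeft_tmul, baseCounit_tmul, _root_.one_mul,
          Algebra.TensorProduct.lift_tmul, AlgHom.id_apply, AlgHom.comp_apply, Algebra.ofId_apply]
        rw [← Algebra.smul_def, TensorProduct.tmul_smul, algebraMap_smul]
    rw [baseComul_tmul, map_smul, key, hl, TensorProduct.smul_tmul', smul_eq_mul, _root_.mul_one]

/-- This lets the coordinates of the fibre be chosen in `ker ε ⊆ A`, so that they vanish on the unit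
section over the base and not merely on the fibre. -/
lemma mem_span_of_baseCounit_eq_zero (ε : A →ₐ[R] R) {b : k ⊗[R] A} (hb : baseCounit k ε b = 0) :
    b ∈ Submodule.span k (Set.range fun a : RingHom.ker ε => (1 : k) ⊗ₜ[R] (a : A)) := by
  have h : ∀ b : k ⊗[R] A, b - baseCounit k ε b • 1 ∈
      Submodule.span k (Set.range fun a : RingHom.ker ε => (1 : k) ⊗ₜ[R] (a : A)) := by
    intro b
    induction b with
    | zero => simp
    | add x y hx hy =>
      rw [map_add, add_smul, add_sub_add_comm]
      exact add_mem hx hy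
    | tmul c a =>
      have h1 : c ⊗ₜ[R] a - baseCounit k ε (c ⊗ₜ a) • 1 =
          c • ((1 : k) ⊗ₜ[R] (a - algebraMap R A (ε a))) := by
        rw [baseCounit_tmul, TensorProduct.tmul_sub, smul_sub, TensorProduct.smul_tmul',
          smul_eq_mul, _root_.mul_one, Algebra.algebraMap_eq_smul_one (A := A),
          TensorProduct.tmul_smul, mul_smul, algebraMap_smul]
        rfl
      rw [h1]
      exact Submodule.smul_mem _ _ (Submodule.subset_span
        ⟨⟨a - algebraMap R A (ε a), by simp [RingHom.mem_ker]⟩, rfl⟩)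
  simpa [hb] using h b

/-- If the `p ^ n`-power map kills the augmentation ideal of a finite flat algebra with a
comultiplication, and the `p ^ m`-power map is exact on the fibre at `P`, then the algebra is
truncated polynomial, compatibly with the augmentation, over a neighbourhood of `P`. -/
theorem exists_monom_basis_away (p : ℕ) [Fact p.Prime] (hp0 : (p : R) = 0)
    [Module.Finite R A] [Module.FinitePresentation R A] [Module.Flat R A]
    (ε : A →ₐ[R] R) (Δ : A →ₐ[R] A ⊗[R] A)
    (hl : ∀ a, Algebra.TensorProduct.lift ((Algebra.ofId R A).comp ε) (AlgHom.id R A)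
      (fun _ _ => .all _ _) (Δ a) = a)
    (hr : ∀ a, Algebra.TensorProduct.lift (AlgHom.id R A) ((Algebra.ofId R A).comp ε)
      (fun _ _ => .all _ _) (Δ a) = a)
    {m n : ℕ} (hm : 1 ≤ m) (hmn : m < n) (hkill : ∀ a, ε a = 0 → a ^ p ^ n = 0)
    (P : Ideal R) [P.IsPrime] [Algebra P.ResidueField k] [IsScalarTower R P.ResidueField k]
    (hfrob : ∀ l ≤ n - m, ∀ b : k ⊗[R] A,
      b ^ p ^ m ∈ frobIdeal (RingHom.ker (baseCounit k ε)) (p ^ (m + l)) →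
      b ∈ frobIdeal (RingHom.ker (baseCounit k ε)) (p ^ l)) :
    ∃ f ∉ P, ∃ (r : ℕ) (x : Fin r → A), (∀ i, ε (x i) = 0) ∧
      ∀ (R' : Type u) [CommRing R'] [Algebra R R'] [IsLocalization.Away f R']
        (A' : Type u) [AddCommGroup A'] [Module R A'] [Module R' A'] [IsScalarTower R R' A']
        (g : A →ₗ[R] A') [IsLocalizedModule (Submonoid.powers f) g],
        LinearIndependent R' (fun α : Fin r → Fin (p ^ n) => g (monom x fun i => α i)) ∧
        Submodule.span R'
          (Set.range fun α : Fin r → Fin (p ^ n) => g (monom x fun i => α i)) = ⊤ := by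
  have hp : p.Prime := Fact.out
  have hchar : CharP k p := by
    have h : (p : k) = 0 := by rw [← map_natCast (algebraMap R k), hp0, map_zero]
    exact (CharP.charP_iff_prime_eq_zero hp).2 h
  have hnt : Nontrivial (k ⊗[R] A) := (baseCounit k ε).toRingHom.domain_nontrivial
  have hexp : ExpChar (k ⊗[R] A) p :=
    have : ExpChar k p := ExpChar.prime hp
    expChar_of_injective_algebraMap (algebraMap k (k ⊗[R] A)).injective p
  have hkillk : ∀ b, baseCounit k ε b = 0 → b ^ p ^ n = 0 := by
    intro b hb
    refine Submodule.span_induction (p := fun b _ => b ^ p ^ n = 0) ?_ ?_ ?_ ?_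
      (mem_span_of_baseCounit_eq_zero k ε hb)
    · rintro _ ⟨⟨a, ha⟩, rfl⟩
      simp only [Algebra.TensorProduct.tmul_pow, hkill a ha, TensorProduct.tmul_zero]
    · exact zero_pow (pow_ne_zero _ hp.ne_zero)
    · intro a b _ _ ha hb
      rw [add_pow_expChar_pow, ha, hb, add_zero]
    · intro c a _ ha
      rw [smul_pow, ha, smul_zero]
  have hnil : ∀ b ∈ RingHom.ker (baseCounit k ε), IsNilpotent b := fun b hb => ⟨_, hkillk b hb⟩
  have : IsNoetherianRing (k ⊗[R] A) := IsNoetherianRing.of_finite k _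
  have hnilI : IsNilpotent (RingHom.ker (baseCounit k ε)) := by
    obtain ⟨N, hN⟩ := IsNoetherianRing.isNilpotent_nilradical (k ⊗[R] A)
    refine ⟨N, le_bot_iff.1 (le_trans (Ideal.pow_right_mono ?_ N) hN.le)⟩
    exact fun b hb => mem_nilradical.2 (hnil b hb)
  let q : k ⊗[R] A →ₗ[k] (k ⊗[R] A) ⧸ (RingHom.ker (baseCounit k ε) ^ 2) :=
    (Ideal.Quotient.mkₐ k (RingHom.ker (baseCounit k ε) ^ 2)).toLinearMap
  have hq : ∀ b, q b = 0 ↔ b ∈ RingHom.ker (baseCounit k ε) ^ 2 :=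
    fun b => Ideal.Quotient.eq_zero_iff_mem
  -- A basis of the cotangent space extracted from the classes of `1 ⊗ a` with `a ∈ ker ε`.
  obtain ⟨T, a, -, hspan, hli⟩ := exists_linearIndependent' k
    (fun a : RingHom.ker ε => q ((1 : k) ⊗ₜ[R] (a : A)))
  have hT : Finite T := hli.finite
  obtain ⟨r, ⟨e⟩⟩ := Finite.exists_equiv_fin T
  let x : Fin r → A := fun i => a (e.symm i)
  have hxε : ∀ i, ε (x i) = 0 := fun i => (a (e.symm i)).2
  have hxq : LinearIndependent k fun i => q ((1 : k) ⊗ₜ[R] x i) :=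
    hli.comp _ e.symm.injective
  have hxspan : ∀ b ∈ RingHom.ker (baseCounit k ε), ∃ c : Fin r → k,
      b - ∑ i, c i • ((1 : k) ⊗ₜ[R] x i) ∈ RingHom.ker (baseCounit k ε) ^ 2 := by
    intro b hb
    have h1 : q b ∈ Submodule.span k (Set.range fun i => q ((1 : k) ⊗ₜ[R] x i)) := by
      have h2 : (Set.range fun i => q ((1 : k) ⊗ₜ[R] x i)) = Set.range
          ((fun a : RingHom.ker ε => q ((1 : k) ⊗ₜ[R] (a : A))) ∘ a) :=
        e.symm.surjective.range_comp
          ((fun a : RingHom.ker ε => q ((1 : k) ⊗ₜ[R] (a : A))) ∘ a)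
      rw [h2, hspan]
      have h3 := Submodule.mem_map_of_mem (f := q) (mem_span_of_baseCounit_eq_zero k ε hb)
      rwa [Submodule.map_span, ← Set.range_comp] at h3
    obtain ⟨c, hc⟩ := (Submodule.mem_span_range_iff_exists_fun k).1 h1
    refine ⟨c, (hq _).1 ?_⟩
    rw [map_sub, map_sum, ← hc]
    simp
  have hxk : ∀ i, baseCounit k ε ((1 : k) ⊗ₜ[R] x i) = 0 := fun i => by simp [hxε]
  have hxN : ∀ i, ((1 : k) ⊗ₜ[R] x i) ^ p ^ n = 0 := fun i => hkillk _ (hxk i)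
  have htop := monom_notMem_frobIdeal p (baseCounit k ε) (baseComul k Δ)
    (fun i => (1 : k) ⊗ₜ[R] x i) (evalLeft_baseComul k ε Δ hl) (evalRight_baseComul k ε Δ hr) hnil
    hxq hxk hm hmn hfrob n le_rfl
  have hmon : ∀ α : Fin r → ℕ,
      monom (fun i => (1 : k) ⊗ₜ[R] x i) α = (1 : k) ⊗ₜ[R] monom x α := by
    intro α
    simp only [monom, Algebra.TensorProduct.tmul_pow, one_pow]
    exact (map_prod (Algebra.TensorProduct.includeRight (R := R) (A := k) (B := A))
      (fun i => x i ^ α i) Finset.univ).symm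
  have hbli := linearIndependent_monom (k := k) (fun i => (1 : k) ⊗ₜ[R] x i) (N := p ^ n) hxN
    (fun h => htop (h ▸ zero_mem _))
  have hbsp := span_monom_eq_top (baseCounit k ε) (fun i => (1 : k) ⊗ₜ[R] x i) hnilI hxk hxspan
    (pow_ne_zero n hp.ne_zero) hxN
  simp only [hmon] at hbli hbsp
  obtain ⟨f, hf, H⟩ := exists_notMem_basis_away.{u}
    (fun α : Fin r → Fin (p ^ n) => monom x fun i => (α i : ℕ)) P k hbli hbsp
  exact ⟨f, hf, r, x, hxε, fun R' _ _ _ A' _ _ _ _ g _ => H R' A' g⟩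

end BaseChange

/-! ### Unit sections and relative Frobenius after projection from the twist. -/

lemma one_pullback_fst {S T : Scheme.{u}} (f : T ⟶ S) (G : Over S) [GrpObj G] :
    η[(Over.pullback f).obj G].left ≫ pullback.fst G.hom f = f ≫ η[G].left := by
  have h1 : η[(Over.pullback f).obj G] = Functor.LaxMonoidal.ε (Over.pullback f) ≫
    (Over.pullback f).map η[G] := rfl
  have h2 : ((Over.pullback f).map η[G]).left ≫ pullback.fst G.hom f =
      pullback.fst _ _ ≫ η[G].left := pullback.lift_fst _ _ _
  rw [h1, Over.comp_left, Category.assoc, h2, Over.ε_pullback_left, ← Category.assoc]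
  congr 1
  rw [IsIso.inv_comp_eq]
  have := pullback.condition (f := 𝟙 S) (g := f)
  rwa [Category.comp_id] at this

section Frobenius

variable (p : ℕ) [Fact p.Prime]

lemma absFrob_Spec (k : ℕ) (B : CommRingCat.{u}) (h : (p : Γ(Spec B, ⊤)) = 0) (hB : (p : B) = 0) :
    absFrob p k (Spec B) h = Spec.map (CommRingCat.ofHom (ringFrob p k B hB)) := by
  refine ext_to_Spec ?_
  ext b
  have h1 := congrArg (fun f => f.hom b)
    (Scheme.ΓSpecIso_inv_naturality (CommRingCat.ofHom (ringFrob p k B hB)))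
  exact (map_pow (Scheme.ΓSpecIso B).inv.hom b (p ^ k)).symm.trans h1

variable {S : Scheme.{u}} (hS : (p : Γ(S, ⊤)) = 0)

lemma twist_hom_ext (k : ℕ) {T X : Over S} {f g : T ⟶ twist p hS k X}
    (h : f.left ≫ twistProj p hS k X = g.left ≫ twistProj p hS k X) : f = g := by
  ext1
  exact pullback.hom_ext h ((Over.w f).trans (Over.w g).symm)

lemma twistLift_proj (k : ℕ) {T X : Over S} (f : T.left ⟶ X.left)
    (hf : f ≫ X.hom = T.hom ≫ absFrob p k S hS) :
    (twistLift p hS k f hf).left ≫ twistProj p hS k X = f :=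
  pullback.lift_fst _ _ _

lemma relFrob_proj (k : ℕ) (X : Over S) :
    (relFrob p hS k X).left ≫ twistProj p hS k X =
      absFrob p k X.left (natCast_of_hom X.hom hS) :=
  twistLift_proj _ _ _ _ _

lemma relFrobTwist_proj {m n : ℕ} (h : m ≤ n) (X : Over S) :
    (relFrobTwist p hS h X).left ≫ twistProj p hS n X =
      absFrob p (n - m) (twist p hS m X).left (natCast_of_hom (twist p hS m X).hom hS) ≫
        twistProj p hS m X := by
  rw [relFrobTwist, Over.comp_left, Category.assoc, twistTwist, twistLift_proj, ← Category.assoc,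
    relFrob_proj]

lemma one_twist_proj (k : ℕ) (G : Over S) [GrpObj G] :
    η[twist p hS k G].left ≫ twistProj p hS k G = absFrob p k S hS ≫ η[G].left :=
  one_pullback_fst _ _

lemma absFrob_eq_of_killedByFrob (n : ℕ) (G : Over S) [GrpObj G] (h : KilledByFrob p hS n G) :
    absFrob p n G.left (natCast_of_hom G.hom hS) = G.hom ≫ absFrob p n S hS ≫ η[G].left := by
  rw [← one_twist_proj, ← relFrob_proj, h, Over.comp_left, Category.assoc]
  rfl

end Frobenius

/-! ### Group law and exactness on an affine chart. -/

section Chart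

variable {S : Scheme.{u}} {G : Over S} [GrpObj G] {R A : CommRingCat.{u}} {iU : Spec R ⟶ S}
  {iV : Spec A ⟶ G.left} {α : R ⟶ A}

lemma exists_counit (H : IsPullback iV (Spec.map α) G.hom iU) :
    ∃ ε : A ⟶ R, α ≫ ε = 𝟙 R ∧ Spec.map ε ≫ iV = iU ≫ η[G].left := by
  have hη : η[G].left ≫ G.hom = 𝟙 S := Over.w η[G]
  let w : Spec R ⟶ Spec A := H.lift (iU ≫ η[G].left) (𝟙 _) (by
    rw [Category.assoc, hη, Category.comp_id]; exact (Category.id_comp _).symm)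
  refine ⟨Spec.preimage w, Spec.map_injective ?_, ?_⟩
  · rw [Spec.map_comp, Spec.map_preimage, Spec.map_id]
    exact H.lift_snd _ _ _
  · rw [Spec.map_preimage]
    exact H.lift_fst _ _ _

/-- `Δ` is the product of the two `B`-points `β₁`, `β₂` of `G`; it lies over the same point of the
base, hence stays in the chart. The two implications are the unit laws. -/
lemma exists_comul [Mono iV] (H : IsPullback iV (Spec.map α) G.hom iU) {ε : A ⟶ R} (hε : Spec.map ε ≫ iV = iU ≫ η[G].left)
    {B : CommRingCat.{u}} (β₁ β₂ : A ⟶ B) (hβ : α ≫ β₁ = α ≫ β₂) :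
    ∃ Δ : A ⟶ B, α ≫ Δ = α ≫ β₁ ∧
      (∀ (C : CommRingCat.{u}) (c : B ⟶ C), β₁ ≫ c = ε ≫ α ≫ β₁ ≫ c → Δ ≫ c = β₂ ≫ c) ∧
      (∀ (C : CommRingCat.{u}) (c : B ⟶ C), β₂ ≫ c = ε ≫ α ≫ β₂ ≫ c → Δ ≫ c = β₁ ≫ c) := by
  let T : Over S := Over.mk (Spec.map (α ≫ β₁) ≫ iU)
  let P₁ : T ⟶ G := Over.homMk (Spec.map β₁ ≫ iV) (by
    rw [Category.assoc, H.w, ← Category.assoc, ← Spec.map_comp]; rfl)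
  let P₂ : T ⟶ G := Over.homMk (Spec.map β₂ ≫ iV) (by
    rw [Category.assoc, H.w, ← Category.assoc, ← Spec.map_comp, ← hβ]; rfl)
  let Q : T ⟶ G := lift P₁ P₂ ≫ μ
  let w : Spec B ⟶ Spec A := H.lift Q.left (Spec.map (α ≫ β₁)) (Over.w Q)
  have hw : Spec.map (Spec.preimage w) ≫ iV = Q.left := by
    rw [Spec.map_preimage]; exact H.lift_fst _ _ _
  refine ⟨Spec.preimage w, Spec.map_injective ?_, fun C c hc => ?_, fun C c hc => ?_⟩
  · rw [Spec.map_comp, Spec.map_preimage]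
    exact H.lift_snd _ _ _
  · let T' : Over S := Over.mk (Spec.map (α ≫ β₁ ≫ c) ≫ iU)
    let h : T' ⟶ T := Over.homMk (Spec.map c) (by simp [T, T'])
    have h1 : h ≫ P₁ = toUnit T' ≫ η[G] := by
      ext1
      change Spec.map c ≫ Spec.map β₁ ≫ iV = (Spec.map (α ≫ β₁ ≫ c) ≫ iU) ≫ η[G].left
      rw [Category.assoc, ← hε, ← Spec.map_comp_assoc, ← Spec.map_comp_assoc]
      exact congrArg (fun f => Spec.map f ≫ iV) hc
    have h2 : h ≫ Q = h ≫ P₂ := by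
      rw [← Category.assoc, comp_lift, h1, lift_comp_one_left]
    have h3 : Spec.map c ≫ Q.left = Spec.map c ≫ Spec.map β₂ ≫ iV := congrArg (·.left) h2
    refine Spec.map_injective ((cancel_mono iV).1 ?_)
    rw [Spec.map_comp, Category.assoc, hw, h3, Spec.map_comp, Category.assoc]
  · let T' : Over S := Over.mk (Spec.map (α ≫ β₁ ≫ c) ≫ iU)
    let h : T' ⟶ T := Over.homMk (Spec.map c) (by simp [T, T'])
    have h1 : h ≫ P₂ = toUnit T' ≫ η[G] := by
      ext1
      change Spec.map c ≫ Spec.map β₂ ≫ iV = (Spec.map (α ≫ β₁ ≫ c) ≫ iU) ≫ η[G].left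
      rw [Category.assoc, ← hε, ← Spec.map_comp_assoc, ← Spec.map_comp_assoc, reassoc_of% hβ]
      exact congrArg (fun f => Spec.map f ≫ iV) hc
    have h2 : h ≫ Q = h ≫ P₁ := by
      rw [← Category.assoc, comp_lift, h1, lift_comp_one_right]
    have h3 : Spec.map c ≫ Q.left = Spec.map c ≫ Spec.map β₁ ≫ iV := congrArg (·.left) h2
    refine Spec.map_injective ((cancel_mono iV).1 ?_)
    rw [Spec.map_comp, Category.assoc, hw, h3, Spec.map_comp, Category.assoc]


/-- The functions `b` and `0` are two maps to the affine line that agree on a cover, and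
representable presheaves are fpqc sheaves. -/
lemma eq_zero_of_mem_fpqcTopology {B : CommRingCat.{u}} {W : Sieve (Spec B)}
    (hW : W ∈ Scheme.fpqcTopology (Spec B)) (b : B)
    (h : ∀ (Z : Scheme.{u}) (g : Z ⟶ Spec B), W g →
      ((Scheme.ΓSpecIso B).inv ≫ g.appTop).hom b = 0) : b = 0 := by
  let u : CommRingCat.of (Polynomial B) ⟶ B := CommRingCat.ofHom (Polynomial.evalRingHom b)
  let v : CommRingCat.of (Polynomial B) ⟶ B := CommRingCat.ofHom (Polynomial.evalRingHom 0)
  have huv : Spec.map u = Spec.map v := by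
    refine ((GrothendieckTopology.Subcanonical.isSheaf_of_isRepresentable
      (J := Scheme.fpqcTopology) (yoneda.obj (Spec (.of (Polynomial B))))).isSeparated _
        hW).ext ?_
    intro Z g hg
    change g ≫ Spec.map u = g ≫ Spec.map v
    refine ext_to_Spec ?_
    have hc : ∀ f : CommRingCat.of (Polynomial B) ⟶ B,
        (Scheme.ΓSpecIso (.of (Polynomial B))).inv ≫ Scheme.Γ.map (g ≫ Spec.map f).op =
          f ≫ (Scheme.ΓSpecIso B).inv ≫ g.appTop := fun f => by
      rw [← Category.assoc, Scheme.ΓSpecIso_inv_naturality, Category.assoc]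
      exact congrArg _ (Scheme.Hom.comp_appTop g (Spec.map f))
    rw [hc, hc]
    refine CommRingCat.hom_ext (Polynomial.ringHom_ext (fun a => ?_) ?_)
    · exact congrArg ((Scheme.ΓSpecIso B).inv ≫ g.appTop).hom
        ((Polynomial.eval_C (a := a) (x := b)).trans (Polynomial.eval_C (x := 0)).symm)
    · refine (congrArg ((Scheme.ΓSpecIso B).inv ≫ g.appTop).hom
        (Polynomial.eval_X (x := b))).trans ((h Z g hg).trans ?_)
      exact ((congrArg ((Scheme.ΓSpecIso B).inv ≫ g.appTop).hom
        (Polynomial.eval_X (x := 0))).trans (map_zero _)).symm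
  have := congrArg (fun f => f.hom Polynomial.X) (Spec.map_injective huv)
  simpa [u, v] using this

/-- What exactness says about a `B`-valued point of `(Fr_S^m)^* G` killed by `F^(n-m)`. -/
lemma eq_zero_of_fpqcExact (p : ℕ) [Fact p.Prime] (hS : (p : Γ(S, ⊤)) = 0) [Mono iV]
    (H : IsPullback iV (Spec.map α) G.hom iU) {ε : A ⟶ R} (hε : Spec.map ε ≫ iV = iU ≫ η[G].left)
    {m n : ℕ} (hmn : m ≤ n) (hexact : FpqcExact (relFrob p hS m G) (relFrobTwist p hS hmn G))
    {B : CommRingCat.{u}} (hB : (p : B) = 0) (θ : R ⟶ B) (φ : A ⟶ B)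
    (hφ : α ≫ φ = θ ≫ CommRingCat.ofHom (ringFrob p m B hB))
    (hφn : φ ≫ CommRingCat.ofHom (ringFrob p (n - m) B hB) =
      ε ≫ α ≫ φ ≫ CommRingCat.ofHom (ringFrob p (n - m) B hB)) (b : B)
    (h : ∀ (D : CommRingCat.{u}) (g : B ⟶ D) (ψ : A ⟶ D), α ≫ ψ = θ ≫ g →
      (∀ a, ψ.hom a ^ p ^ m = g.hom (φ.hom a)) → g.hom b = 0) : b = 0 := by
  let T : Over S := Over.mk (Spec.map θ ≫ iU)
  have hT : (p : Γ(T.left, ⊤)) = 0 := natCast_of_hom T.hom hS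
  have hFT : ∀ k, absFrob p k T.left hT = Spec.map (CommRingCat.ofHom (ringFrob p k B hB)) :=
    fun k => absFrob_Spec p k B _ hB
  -- A point of the twist over `θ` is a point `φ` of `G` over `Fr^m ∘ θ`.
  let x : T ⟶ twist p hS m G := twistLift p hS m (Spec.map φ ≫ iV) (by
    rw [← absFrob_naturality p m T.hom hT hS, hFT, Category.assoc, H.w, ← Spec.map_comp_assoc, hφ,
      Spec.map_comp_assoc]
    rfl)
  have hx : x.left ≫ twistProj p hS m G = Spec.map φ ≫ iV := twistLift_proj _ _ _ _ _
  have hx1 : x ≫ relFrobTwist p hS hmn G = toUnit T ≫ η[twist p hS n G] := by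
    refine twist_hom_ext p hS n ?_
    have h1 : absFrob p n T.left hT = absFrob p (n - m) T.left hT ≫ absFrob p m T.left hT := by
      rw [absFrob_comp, Nat.sub_add_cancel hmn]
    have h2 : (toUnit T ≫ η[twist p hS n G]).left ≫ twistProj p hS n G =
        absFrob p n T.left hT ≫ T.hom ≫ η[G].left := by
      rw [← Category.assoc, absFrob_naturality p n T.hom hT hS, Category.assoc, ← one_twist_proj,
        Over.comp_left, Category.assoc]
      rfl
    rw [h2, Over.comp_left, Category.assoc, relFrobTwist_proj, ← Category.assoc,
      ← absFrob_naturality p (n - m) x.left hT, Category.assoc, hx, h1, hFT, hFT]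
    change _ = _ ≫ (Spec.map θ ≫ iU) ≫ η[G].left
    simp only [Category.assoc]
    rw [← hε]
    simp only [← Spec.map_comp_assoc, Category.assoc]
    rw [hφn, reassoc_of% hφ]
  obtain ⟨W, hW, hlift⟩ := hexact.locally_lifts T x hx1
  refine eq_zero_of_mem_fpqcTopology hW b fun Z g hg => ?_
  rw [Sieve.overEquiv_iff] at hg
  obtain ⟨y, hy⟩ := hlift _ hg
  let w : Z ⟶ Spec A := H.lift y.left (g ≫ Spec.map θ) (by
    rw [Over.w y, Category.assoc]; rfl)
  have hw1 : w ≫ iV = y.left := H.lift_fst _ _ _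
  have hw2 : w ≫ Spec.map α = g ≫ Spec.map θ := H.lift_snd _ _ _
  have hZ : (p : Γ(Z, ⊤)) = 0 := natCast_of_hom (g ≫ T.hom) hS
  -- The relation `F^m(y) = x`, projected from the twist to `G`, says that `p^m`-th powers of the
  -- coordinates of `y` are those of `x`.
  have hw3 : absFrob p m Z hZ ≫ w = g ≫ Spec.map φ := by
    have h3 : absFrob p m Z hZ ≫ y.left =
        y.left ≫ absFrob p m G.left (natCast_of_hom G.hom hS) := absFrob_naturality _ _ _ _ _
    rw [← cancel_mono iV, Category.assoc, hw1, Category.assoc, ← hx, h3, ← relFrob_proj p hS]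
    exact congrArg (fun f => f.left ≫ twistProj p hS m G) hy
  have hcomp : ∀ {R₁ R₂ : CommRingCat.{u}} (f : R₁ ⟶ R₂) (t : Z ⟶ Spec R₂),
      (Scheme.ΓSpecIso R₁).inv ≫ (t ≫ Spec.map f).appTop =
        f ≫ (Scheme.ΓSpecIso R₂).inv ≫ t.appTop := fun f t => by
    rw [← Category.assoc, Scheme.ΓSpecIso_inv_naturality, Category.assoc, Scheme.Hom.comp_appTop]
  refine h Γ(Z, ⊤) _ ((Scheme.ΓSpecIso A).inv ≫ w.appTop) ?_ ?_
  · rw [← hcomp, ← hcomp, hw2]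
  · intro a
    have := congrArg (fun f => ((Scheme.ΓSpecIso A).inv ≫ Scheme.Hom.appTop f).hom a) hw3
    rw [hcomp] at this
    refine Eq.trans ?_ this
    rw [Scheme.Hom.comp_appTop]
    rfl

end Chart

/-! ### Coordinate-ring form of the hypotheses. -/

section AffineChart

open scoped TensorProduct

variable {S : Scheme.{u}} {G : Over S} [GrpObj G] {R A : Type u} [CommRing R] [CommRing A]
  [Algebra R A] {iU : Spec (.of R) ⟶ S} {iV : Spec (.of A) ⟶ G.left}

lemma exists_counit_algHom
    (H : IsPullback iV (Spec.map (CommRingCat.ofHom (algebraMap R A))) G.hom iU) :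
    ∃ ε : A →ₐ[R] R, Spec.map (CommRingCat.ofHom ε.toRingHom) ≫ iV = iU ≫ η[G].left := by
  obtain ⟨ε, h1, h2⟩ := exists_counit H
  exact ⟨{ ε.hom with commutes' := fun r => congrArg (fun f => f.hom r) h1 }, h2⟩

lemma exists_comul_algHom [Mono iV]
    (H : IsPullback iV (Spec.map (CommRingCat.ofHom (algebraMap R A))) G.hom iU)
    {ε : A →ₐ[R] R} (hε : Spec.map (CommRingCat.ofHom ε.toRingHom) ≫ iV = iU ≫ η[G].left) :
    ∃ Δ : A →ₐ[R] A ⊗[R] A,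
      (∀ a, Algebra.TensorProduct.lift ((Algebra.ofId R A).comp ε) (AlgHom.id R A)
        (fun _ _ => .all _ _) (Δ a) = a) ∧
      (∀ a, Algebra.TensorProduct.lift (AlgHom.id R A) ((Algebra.ofId R A).comp ε)
        (fun _ _ => .all _ _) (Δ a) = a) := by
  let β₁ : CommRingCat.of A ⟶ CommRingCat.of (A ⊗[R] A) :=
    CommRingCat.ofHom (Algebra.TensorProduct.includeLeft (R := R) (S := R)).toRingHom
  let β₂ : CommRingCat.of A ⟶ CommRingCat.of (A ⊗[R] A) :=
    CommRingCat.ofHom (Algebra.TensorProduct.includeRight (R := R)).toRingHom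
  have hβ₁ : CommRingCat.ofHom (algebraMap R A) ≫ β₁ =
      CommRingCat.ofHom (algebraMap R (A ⊗[R] A)) := by
    ext r
    exact (Algebra.TensorProduct.includeLeft (R := R) (S := R) (A := A) (B := A)).commutes r
  have hβ₂ : CommRingCat.ofHom (algebraMap R A) ≫ β₂ =
      CommRingCat.ofHom (algebraMap R (A ⊗[R] A)) := by
    ext r
    exact (Algebra.TensorProduct.includeRight (R := R) (A := A) (B := A)).commutes r
  obtain ⟨Δ, h1, h2, h3⟩ := exists_comul H hε β₁ β₂ (hβ₁.trans hβ₂.symm)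
  rw [hβ₁] at h1
  refine ⟨{ Δ.hom with commutes' := fun r => congrArg (fun f => f.hom r) h1 }, ?_, ?_⟩
  · let c : CommRingCat.of (A ⊗[R] A) ⟶ CommRingCat.of A := CommRingCat.ofHom
      (Algebra.TensorProduct.lift ((Algebra.ofId R A).comp ε) (AlgHom.id R A)
        (fun _ _ => .all _ _)).toRingHom
    have := h2 (.of A) c (by
      ext a
      simp [c, β₁, Algebra.ofId_apply])
    intro a
    refine (congrArg (fun f => f.hom a) this).trans ?_
    simp [c, β₂]
  · let c : CommRingCat.of (A ⊗[R] A) ⟶ CommRingCat.of A := CommRingCat.ofHom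
      (Algebra.TensorProduct.lift (AlgHom.id R A) ((Algebra.ofId R A).comp ε)
        (fun _ _ => .all _ _)).toRingHom
    have := h3 (.of A) c (by
      ext a
      simp [c, β₂, Algebra.ofId_apply])
    intro a
    refine (congrArg (fun f => f.hom a) this).trans ?_
    simp [c, β₁]

variable (p : ℕ) [Fact p.Prime] (hS : (p : Γ(S, ⊤)) = 0)

lemma pow_eq_zero_of_killedByFrob [Mono iV]
    (H : IsPullback iV (Spec.map (CommRingCat.ofHom (algebraMap R A))) G.hom iU)
    {ε : A →ₐ[R] R} (hε : Spec.map (CommRingCat.ofHom ε.toRingHom) ≫ iV = iU ≫ η[G].left)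
    (hR : (p : R) = 0) {n : ℕ} (h : KilledByFrob p hS n G) (a : A) (ha : ε a = 0) :
    a ^ p ^ n = 0 := by
  have hA : (p : A) = 0 := by rw [← map_natCast (algebraMap R A), hR, map_zero]
  have h1 := absFrob_eq_of_killedByFrob p hS n G h
  have hUS : (p : Γ(Spec (.of R), ⊤)) = 0 := natCast_of_hom iU hS
  have hVS : (p : Γ(Spec (.of A), ⊤)) = 0 := natCast_of_hom (iV ≫ G.hom) hS
  have h2 : Spec.map (CommRingCat.ofHom (ringFrob p n A hA)) ≫ iV =
      Spec.map (CommRingCat.ofHom ε.toRingHom ≫ CommRingCat.ofHom (ringFrob p n R hR) ≫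
        CommRingCat.ofHom (algebraMap R A)) ≫ iV := by
    rw [← absFrob_Spec p n (.of A) hVS hA, absFrob_naturality p n iV hVS (natCast_of_hom G.hom hS),
      h1, ← Category.assoc, H.w, Category.assoc, ← Category.assoc iU,
      ← absFrob_naturality p n iU hUS, absFrob_Spec p n (.of R) hUS hR, Category.assoc, ← hε]
    simp only [← Spec.map_comp_assoc, Category.assoc]
  have h3 := congrArg (fun f => f.hom a) (Spec.map_injective ((cancel_mono iV).1 h2))
  refine h3.trans ?_
  change algebraMap R A ((ε a) ^ p ^ n) = 0
  rw [ha, zero_pow (pow_ne_zero _ (Fact.out : p.Prime).ne_zero), map_zero]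

/-- Exactness of `G → (Fr^m)^* G → (Fr^n)^* G` on the fibre over a perfect field. -/
lemma mem_frobIdeal_of_fpqcExact [Mono iV]
    (H : IsPullback iV (Spec.map (CommRingCat.ofHom (algebraMap R A))) G.hom iU)
    {ε : A →ₐ[R] R} (hε : Spec.map (CommRingCat.ofHom ε.toRingHom) ≫ iV = iU ≫ η[G].left)
    {m n : ℕ} (hmn : m ≤ n) (hexact : FpqcExact (relFrob p hS m G) (relFrobTwist p hS hmn G))
    (k : Type u) [Field k] [Algebra R k] [CharP k p] [PerfectRing k p] {l : ℕ} (hl : l ≤ n - m)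
    (b : k ⊗[R] A) (hb : b ^ p ^ m ∈ frobIdeal (RingHom.ker (baseCounit k ε)) (p ^ (m + l))) :
    b ∈ frobIdeal (RingHom.ker (baseCounit k ε)) (p ^ l) := by
  set K := frobIdeal (RingHom.ker (baseCounit k ε)) (p ^ l) with hK
  let σ : k ≃+* k := (iterateFrobeniusEquiv k p m).symm
  have hσ : ∀ c, σ c ^ p ^ m = c := fun c => (iterateFrobeniusEquiv k p m).apply_symm_apply c
  let q : k ⊗[R] A →+* (k ⊗[R] A) ⧸ K := Ideal.Quotient.mk K
  let j : k →+* (k ⊗[R] A) ⧸ K := q.comp (algebraMap k (k ⊗[R] A))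
  -- The universal point of `G[F^l]` on the fibre, made into a point of the twist. For this the
  -- structure map `θ` must be a `p^m`-th root of the usual one; perfectness of `k` supplies the
  -- root `σ`.
  let B : CommRingCat.{u} := .of ((k ⊗[R] A) ⧸ K)
  have hB : (p : B) = 0 := by
    have := map_natCast j p
    rw [CharP.cast_eq_zero, map_zero] at this
    exact this.symm
  let θ : CommRingCat.of R ⟶ B :=
    CommRingCat.ofHom ((j.comp (σ : k →+* k)).comp (algebraMap R k))
  let φ : CommRingCat.of A ⟶ B :=
    CommRingCat.ofHom (q.comp (Algebra.TensorProduct.includeRight (R := R) (A := k)).toRingHom)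
  have hφ : CommRingCat.ofHom (algebraMap R A) ≫ φ =
      θ ≫ CommRingCat.ofHom (ringFrob p m B hB) := by
    ext r
    change q ((1 : k) ⊗ₜ[R] algebraMap R A r) = (j (σ (algebraMap R k r))) ^ p ^ m
    rw [← map_pow, hσ]
    change _ = q (algebraMap k (k ⊗[R] A) (algebraMap R k r))
    congr 1
    rw [← IsScalarTower.algebraMap_apply]
    exact (Algebra.TensorProduct.includeRight (R := R) (A := k) (B := A)).commutes r
  have hφn : φ ≫ CommRingCat.ofHom (ringFrob p (n - m) B hB) =
      CommRingCat.ofHom ε.toRingHom ≫ CommRingCat.ofHom (algebraMap R A) ≫ φ ≫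
        CommRingCat.ofHom (ringFrob p (n - m) B hB) := by
    ext a
    change ringFrob p (n - m) B hB (φ.hom a) =
      ringFrob p (n - m) B hB (φ.hom (algebraMap R A (ε a)))
    rw [← sub_eq_zero, ← map_sub, ← map_sub]
    have h1 : φ.hom (a - algebraMap R A (ε a)) ^ p ^ l = 0 := by
      rw [← map_pow]
      refine Ideal.Quotient.eq_zero_iff_mem.2 ?_
      refine (map_pow (Algebra.TensorProduct.includeRight (R := R) (A := k) (B := A))
        (a - algebraMap R A (ε a)) (p ^ l)).symm ▸ pow_mem_frobIdeal ?_ _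
      simp [RingHom.mem_ker]
    exact pow_eq_zero_of_le
      (Nat.pow_le_pow_right (Fact.out : p.Prime).pos hl) h1
  refine Ideal.Quotient.eq_zero_iff_mem.1 ?_
  refine eq_zero_of_fpqcExact p hS H hε hmn hexact hB θ φ hφ hφn (q b) ?_
  intro D g ψ hψ hψm
  have hD : (p : D) = 0 := by rw [← map_natCast g.hom, hB, map_zero]
  let _ : Algebra R D := (ψ.hom.comp (algebraMap R A)).toAlgebra
  -- With scalars acting through `σ`, the local lift `ψ` extends `k`-linearly to `Ψ`, and
  -- `Ψ(c)^(p^m)` is the image of `c` itself.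
  let _ : Algebra k D := (g.hom.comp (j.comp (σ : k →+* k))).toAlgebra
  have : IsScalarTower R k D := .of_algebraMap_eq fun r => congrArg (fun f => f.hom r) hψ
  let Ψ : k ⊗[R] A →ₐ[k] D := Algebra.TensorProduct.lift (Algebra.ofId k D)
    { ψ.hom with commutes' := fun r => rfl } fun _ _ => .all _ _
  have hΨ : ∀ c, ringFrob p m D hD (Ψ c) = g.hom (q c) := by
    intro c
    induction c with
    | zero => simp
    | add x y hx hy => rw [map_add, map_add, map_add, map_add, hx, hy]
    | tmul c a =>
      have h1 : Ψ (c ⊗ₜ a) = g.hom (j (σ c)) * ψ.hom a := by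
        simp only [Ψ, Algebra.TensorProduct.lift_tmul]
        rfl
      have h2 : c ⊗ₜ[R] a = algebraMap k (k ⊗[R] A) c * ((1 : k) ⊗ₜ[R] a) := by
        simp [Algebra.TensorProduct.algebraMap_apply]
      rw [h1, h2]
      change (g.hom (j (σ c)) * ψ.hom a) ^ p ^ m = _
      rw [mul_pow, hψm, ← map_pow, ← map_pow, hσ, map_mul, map_mul]
      rfl
  rw [← hΨ b]
  change Ψ b ^ p ^ m = 0
  rw [← map_pow]
  -- The lift lands in `G[F^(m+l)]`, because its image under `F^m` lies in the kernel of `F^l`.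
  have hker : frobIdeal (RingHom.ker (baseCounit k ε)) (p ^ (m + l)) ≤ RingHom.ker Ψ := by
    refine frobIdeal_le.2 fun c hc => ?_
    rw [RingHom.mem_ker, map_pow, pow_add, pow_mul]
    have h1 : Ψ c ^ p ^ m = g.hom (q c) := hΨ c
    rw [h1, ← map_pow, ← map_pow, Ideal.Quotient.eq_zero_iff_mem.2 (pow_mem_frobIdeal hc _),
      map_zero]
  exact hker hb

end AffineChart

/-! ### Truncated polynomial rings. -/

section Truncated

open scoped TensorProduct

lemma span_truncPoly_monom (p n r : ℕ) :
    Submodule.span (Fp.{u} p) (Set.range fun α : Fin r → Fin (p ^ n) =>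
      monom (fun i => (Ideal.Quotient.mk (truncIdeal.{u} p n r) (MvPolynomial.X i)))
        fun i => (α i : ℕ)) = ⊤ := by
  rw [eq_top_iff]
  rintro t -
  obtain ⟨f, rfl⟩ := Ideal.Quotient.mk_surjective t
  induction f using MvPolynomial.induction_on' with
  | add f g hf hg => rw [map_add]; exact add_mem hf hg
  | monomial s c =>
    have h1 : Ideal.Quotient.mk (truncIdeal.{u} p n r) (MvPolynomial.monomial s c) =
        c • monom (fun i => (Ideal.Quotient.mk (truncIdeal.{u} p n r) (MvPolynomial.X i))) s := by
      rw [MvPolynomial.monomial_eq, ← MvPolynomial.smul_eq_C_mul, Finsupp.prod_fintype _ _ (by simp)]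
      simp only [monom, ← map_pow, ← map_prod]
      rfl
    rw [h1]
    refine Submodule.smul_mem _ _ ?_
    by_cases hs : ∀ i, s i < p ^ n
    · exact Submodule.subset_span ⟨fun i => ⟨s i, hs i⟩, rfl⟩
    · push Not at hs
      obtain ⟨i, hi⟩ := hs
      rw [monom, ← Finset.prod_erase_mul _ _ (Finset.mem_univ i)]
      have h2 : (Ideal.Quotient.mk (truncIdeal.{u} p n r) (MvPolynomial.X i)) ^ s i = 0 := by
        refine pow_eq_zero_of_le hi ?_
        rw [← map_pow]
        exact Ideal.Quotient.eq_zero_iff_mem.2 (Ideal.subset_span ⟨i, rfl⟩)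
      rw [h2, mul_zero]
      exact zero_mem _

variable {p : ℕ} {n r : ℕ} {A : Type u} [CommRing A] [Algebra (Fp.{u} p) A]

/-- The homomorphism from the truncated polynomial ring given by elements with zero
`p ^ n`-th powers. -/
def truncLift (x : Fin r → A) (hx : ∀ i, x i ^ p ^ n = 0) : TruncPoly.{u} p n r →ₐ[Fp.{u} p] A :=
  Ideal.Quotient.liftₐ (truncIdeal p n r) (MvPolynomial.aeval x) (fun a ha => by
    have hle : truncIdeal p n r ≤ RingHom.ker (MvPolynomial.aeval (R := Fp.{u} p) x) := by
      rw [truncIdeal, Ideal.span_le]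
      rintro _ ⟨i, rfl⟩
      simp [RingHom.mem_ker, hx]
    exact hle ha)

lemma truncLift_X (x : Fin r → A) (hx : ∀ i, x i ^ p ^ n = 0) (i : Fin r) :
    truncLift x hx (Ideal.Quotient.mk _ (MvPolynomial.X i)) = x i := by
  exact MvPolynomial.aeval_X x i

lemma truncPoly_ringHom_ext {C : Type*} [CommRing C] {f g : TruncPoly.{u} p n r →+* C}
    (hc : ∀ c : Fp.{u} p, f (algebraMap _ _ c) = g (algebraMap _ _ c))
    (hX : ∀ i, f (Ideal.Quotient.mk _ (MvPolynomial.X i)) =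
      g (Ideal.Quotient.mk _ (MvPolynomial.X i))) : f = g :=
  Ideal.Quotient.ringHom_ext (MvPolynomial.ringHom_ext hc hX)

/-- If the monomials in `x` form a basis of the `R`-algebra `A`, then `A` is the base change of the
truncated polynomial ring. -/
lemma isPushout_truncLift {R : Type u} [CommRing R] [Algebra (Fp.{u} p) R] [Algebra R A]
    [IsScalarTower (Fp.{u} p) R A] (x : Fin r → A) (hx : ∀ i, x i ^ p ^ n = 0)
    (hli : LinearIndependent R fun α : Fin r → Fin (p ^ n) => monom x fun i => (α i : ℕ))
    (hsp : Submodule.span R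
      (Set.range fun α : Fin r → Fin (p ^ n) => monom x fun i => (α i : ℕ)) = ⊤) :
    IsPushout (CommRingCat.ofHom (algebraMap (Fp.{u} p) R))
      (CommRingCat.ofHom (algebraMap (Fp.{u} p) (TruncPoly.{u} p n r)))
      (CommRingCat.ofHom (algebraMap R A))
      (CommRingCat.ofHom (R := TruncPoly.{u} p n r) (truncLift x hx).toRingHom) := by
  let Ψ : R ⊗[Fp.{u} p] TruncPoly.{u} p n r →ₐ[R] A :=
    Algebra.TensorProduct.lift (Algebra.ofId R A) (truncLift x hx) fun _ _ => .all _ _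
  let v : (Fin r → Fin (p ^ n)) → TruncPoly.{u} p n r := fun α =>
    monom (fun i => (Ideal.Quotient.mk (truncIdeal.{u} p n r) (MvPolynomial.X i)))
        fun i => (α i : ℕ)
  have hΨv : ∀ α, Ψ ((1 : R) ⊗ₜ v α) = monom x fun i => (α i : ℕ) := by
    intro α
    simp only [Ψ, Algebra.TensorProduct.lift_tmul, map_one, _root_.one_mul, v, monom, map_prod,
      map_pow, truncLift_X]
  have hv : Submodule.span R (Set.range fun α => (1 : R) ⊗ₜ[Fp.{u} p] v α) = ⊤ := by
    have := congrArg (Submodule.baseChange R) (span_truncPoly_monom.{u} p n r)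
    rw [Submodule.baseChange_span, Submodule.baseChange_top, ← Set.range_comp] at this
    exact this
  -- On the left only spanning by monomials is needed; injectivity comes from independence of their
  -- images.
  have hbij : Function.Bijective Ψ := by
    constructor
    · rw [injective_iff_map_eq_zero]
      intro t ht
      obtain ⟨c, rfl⟩ := (Submodule.mem_span_range_iff_exists_fun R).1
        (hv ▸ Submodule.mem_top (x := t))
      rw [map_sum] at ht
      simp only [map_smul, hΨv] at ht
      have := Fintype.linearIndependent_iff.1 hli c ht
      simp [this]
    · intro a
      obtain ⟨c, rfl⟩ := (Submodule.mem_span_range_iff_exists_fun R).1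
        (hsp ▸ Submodule.mem_top (x := a))
      exact ⟨∑ α, c α • ((1 : R) ⊗ₜ v α), by simp only [map_sum, map_smul, hΨv]⟩
  refine (CommRingCat.isPushout_tensorProduct (Fp.{u} p) R (TruncPoly.{u} p n r)).of_iso
    (Iso.refl _) (Iso.refl _) (Iso.refl _)
    (RingEquiv.ofBijective Ψ.toRingHom hbij).toCommRingCatIso ?_ ?_ ?_ ?_
  · simp
  · simp
  · ext c
    simp [Ψ]
  · refine CommRingCat.hom_ext (RingHom.ext fun t => ?_)
    change Ψ ((1 : R) ⊗ₜ t) = truncLift x hx t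
    simp [Ψ]

end Truncated

/-! ### The pointed isomorphism over an affine open. -/

section Final

open scoped TensorProduct

/-- A group scheme is `n`-smooth over an affine open over which the monomials in some functions
vanishing along the unit section form a basis. -/
lemma exists_iso_truncOver (p : ℕ) [Fact p.Prime] {S : Scheme.{u}}
    (π : S ⟶ Spec (.of (Fp.{u} p))) (G : Over S) [GrpObj G] {U : S.Opens} (hU : IsAffineOpen U)
    {A : Type u} [CommRing A] [Algebra Γ(S, U) A] {jV : Spec (.of A) ⟶ G.left} [Mono jV]
    (H : IsPullback jV (Spec.map (CommRingCat.ofHom (algebraMap Γ(S, U) A))) G.hom hU.fromSpec)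
    {ε : A →ₐ[Γ(S, U)] Γ(S, U)}
    (hε : Spec.map (CommRingCat.ofHom ε.toRingHom) ≫ jV = hU.fromSpec ≫ η[G].left)
    {n r : ℕ} (x : Fin r → A) (hx : ∀ i, x i ^ p ^ n = 0) (hxε : ∀ i, ε (x i) = 0)
    (hli : LinearIndependent Γ(S, U)
      fun α : Fin r → Fin (p ^ n) => monom x fun i => (α i : ℕ))
    (hsp : Submodule.span Γ(S, U)
      (Set.range fun α : Fin r → Fin (p ^ n) => monom x fun i => (α i : ℕ)) = ⊤) :
    ∃ e : (Over.pullback U.ι).obj G ≅ truncOver p n r (U.ι ≫ π),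
      η[(Over.pullback U.ι).obj G] ≫ e.hom = truncSection p n r (U.ι ≫ π) := by
  let ρ : CommRingCat.of (Fp.{u} p) ⟶ Γ(S, U) := Spec.preimage (hU.fromSpec ≫ π)
  have hρ : Spec.map ρ = hU.fromSpec ≫ π := Spec.map_preimage _
  let _ : Algebra (Fp.{u} p) Γ(S, U) := ρ.hom.toAlgebra
  let _ : Algebra (Fp.{u} p) A := ((algebraMap Γ(S, U) A).comp ρ.hom).toAlgebra
  have : IsScalarTower (Fp.{u} p) Γ(S, U) A := .of_algebraMap_eq fun _ => rfl
  let c := hU.isoSpec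
  have hc : c.hom ≫ hU.fromSpec = U.ι := by
    rw [← hU.isoSpec_inv_ι, Iso.hom_inv_id_assoc]
  have sq₁ : IsPullback jV (Spec.map (CommRingCat.ofHom (algebraMap Γ(S, U) A)) ≫ c.inv)
      G.hom U.ι :=
    H.of_iso (Iso.refl _) (Iso.refl _) c.symm (Iso.refl _) (by simp) (by simp) (by simp)
      (by simp [c, hU.isoSpec_inv_ι])
  have sq₂ : IsPullback (Spec.map (CommRingCat.ofHom (algebraMap Γ(S, U) A)) ≫ c.inv)
      (Spec.map (CommRingCat.ofHom (R := TruncPoly.{u} p n r) (truncLift x hx).toRingHom))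
      (U.ι ≫ π) (truncStr p n r) :=
    (isPullback_SpecMap_of_isPushout _ _ _ _ (isPushout_truncLift x hx hli hsp)).of_iso
      (Iso.refl _) c.symm (Iso.refl _) (Iso.refl _) (by simp) (by simp)
      (by
        have h1 : CommRingCat.ofHom (algebraMap (Fp.{u} p) Γ(S, U)) = ρ := rfl
        rw [h1, hρ, ← hc]
        simp [c]) (by simp [truncStr])
  let i₁ : pullback G.hom U.ι ≅ Spec (.of A) := sq₁.isoPullback.symm
  let i₂ : Spec (.of A) ≅ pullback (U.ι ≫ π) (truncStr p n r) := sq₂.isoPullback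
  have hi₁ : i₁.hom ≫ jV = pullback.fst _ _ := sq₁.isoPullback_inv_fst
  have hi₁' : i₁.hom ≫ Spec.map (CommRingCat.ofHom (algebraMap Γ(S, U) A)) ≫ c.inv =
    pullback.snd _ _ := sq₁.isoPullback_inv_snd
  let e : (Over.pullback U.ι).obj G ≅ truncOver p n r (U.ι ≫ π) :=
    Over.isoMk (i₁ ≪≫ i₂) (by
      change (i₁.hom ≫ i₂.hom) ≫ pullback.fst _ _ = pullback.snd _ _
      rw [Category.assoc, sq₂.isoPullback_hom_fst, hi₁'])
  refine ⟨e, ?_⟩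
  ext1
  -- Both maps are sections over `U`, so the first components agree; the second are compared on
  -- constants and on the generators, all of which go to zero.
  refine pullback.hom_ext ?_ ?_
  · exact (Over.w (η[(Over.pullback U.ι).obj G] ≫ e.hom)).trans
      (Over.w (truncSection p n r (U.ι ≫ π))).symm
  · have h1 : (truncSection p n r (U.ι ≫ π)).left ≫ pullback.snd _ _ =
        (U.ι ≫ π) ≫ truncPoint p n r := pullback.lift_snd _ _ _
    refine Eq.trans ?_ h1.symm
    change (η[(Over.pullback U.ι).obj G].left ≫ i₁.hom ≫ i₂.hom) ≫ pullback.snd _ _ = _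
    have h2 : η[(Over.pullback U.ι).obj G].left ≫ i₁.hom =
        c.hom ≫ Spec.map (CommRingCat.ofHom ε.toRingHom) := by
      rw [← cancel_mono jV, Category.assoc, hi₁, Category.assoc, hε, ← Category.assoc, hc]
      exact one_pullback_fst _ _
    rw [Category.assoc, Category.assoc, sq₂.isoPullback_hom_snd, reassoc_of% h2, ← hc,
      Category.assoc, Category.assoc, ← Category.assoc hU.fromSpec, ← hρ, truncPoint,
      ← Spec.map_comp, ← Spec.map_comp]
    congr 2
    refine CommRingCat.hom_ext (truncPoly_ringHom_ext (fun a => ?_) fun i => ?_)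
    · change ε (truncLift x hx (algebraMap _ _ a)) = ρ.hom (truncAug p n r (algebraMap _ _ a))
      rw [AlgHom.commutes, IsScalarTower.algebraMap_apply (Fp.{u} p) Γ(S, U) A, AlgHom.commutes]
      refine congrArg ρ.hom ?_
      exact ((MvPolynomial.aeval (R := Fp.{u} p)
        (fun _ : Fin r => (0 : Fp.{u} p))).commutes a).symm
    · change ε (truncLift x hx (Ideal.Quotient.mk _ (MvPolynomial.X i))) =
        ρ.hom (truncAug p n r (Ideal.Quotient.mk _ (MvPolynomial.X i)))
      rw [truncLift_X, hxε]
      refine ((congrArg ρ.hom ?_).trans (map_zero _)).symm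
      exact MvPolynomial.aeval_X _ i

end Final

/-! ### Restricting charts to smaller opens. -/

section ChartBaseChange

open scoped TensorProduct

variable {S : Scheme.{u}} {G : Over S} {R A : Type u} [CommRing R] [CommRing A]
  [Algebra R A] {iU : Spec (.of R) ⟶ S} {iV : Spec (.of A) ⟶ G.left}
  {R' : Type u} [CommRing R'] [Algebra R R'] {iU' : Spec (.of R') ⟶ S}

lemma isPullback_chart_baseChange
    (H : IsPullback iV (Spec.map (CommRingCat.ofHom (algebraMap R A))) G.hom iU)
    (h : Spec.map (CommRingCat.ofHom (algebraMap R R')) ≫ iU = iU') :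
    IsPullback (Spec.map (CommRingCat.ofHom (Algebra.TensorProduct.includeRight
      (R := R) (A := R') (B := A)).toRingHom) ≫ iV)
      (Spec.map (CommRingCat.ofHom (algebraMap R' (R' ⊗[R] A)))) G.hom iU' := by
  subst h
  exact ((isPullback_SpecMap_of_isPushout _ _ _ _
    (CommRingCat.isPushout_tensorProduct R R' A)).flip).paste_horiz H

lemma counit_chart_baseChange [GrpObj G] {ε : A →ₐ[R] R}
    (hε : Spec.map (CommRingCat.ofHom ε.toRingHom) ≫ iV = iU ≫ η[G].left)
    (h : Spec.map (CommRingCat.ofHom (algebraMap R R')) ≫ iU = iU') {ε' : R' ⊗[R] A →ₐ[R'] R'}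
    (hε' : ∀ a, ε' (1 ⊗ₜ a) = algebraMap R R' (ε a)) :
    Spec.map (CommRingCat.ofHom ε'.toRingHom) ≫
      (Spec.map (CommRingCat.ofHom (Algebra.TensorProduct.includeRight
        (R := R) (A := R') (B := A)).toRingHom) ≫ iV) = iU' ≫ η[G].left := by
  subst h
  have h1 : CommRingCat.ofHom (Algebra.TensorProduct.includeRight
      (R := R) (A := R') (B := A)).toRingHom ≫ CommRingCat.ofHom ε'.toRingHom =
      CommRingCat.ofHom ε.toRingHom ≫ CommRingCat.ofHom (algebraMap R R') := by
    ext a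
    exact hε' a
  rw [← Spec.map_comp_assoc, h1, Spec.map_comp_assoc, hε]
  rfl

end ChartBaseChange

section AffineOpen

open scoped TensorProduct

lemma isPullback_fromSpec_appLE {X Y : Scheme.{u}} (f : X ⟶ Y) {U : Y.Opens} (hU : IsAffineOpen U)
    (hV : IsAffineOpen (f ⁻¹ᵁ U)) :
    IsPullback hV.fromSpec (Spec.map (f.appLE U (f ⁻¹ᵁ U) le_rfl)) f hU.fromSpec :=
  (IsOpenImmersion.isPullback _ _ _ _ (hU.SpecMap_appLE_fromSpec f hV le_rfl).symm
    (by rw [hU.opensRange_fromSpec, hV.opensRange_fromSpec])).flip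

lemma mem_basicOpen_of_notMem_primeIdealOf {X : Scheme.{u}} {U : X.Opens} (hU : IsAffineOpen U)
    {x : X} (hx : x ∈ U) {f : Γ(X, U)} (hf : f ∉ (hU.primeIdealOf ⟨x, hx⟩).asIdeal) :
    x ∈ X.basicOpen f := by
  have h : hU.primeIdealOf ⟨x, hx⟩ ∈ hU.fromSpec ⁻¹ᵁ X.basicOpen f := by
    rw [hU.fromSpec_preimage_basicOpen]
    exact hf
  have h2 : hU.fromSpec (hU.primeIdealOf ⟨x, hx⟩) ∈ X.basicOpen f := h
  rwa [hU.fromSpec_primeIdealOf] at h2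

lemma exists_iso_truncOver_basicOpen (p : ℕ) [Fact p.Prime] {S : Scheme.{u}}
    (π : S ⟶ Spec (.of (Fp.{u} p))) (G : Over S) [GrpObj G] {U : S.Opens} (hU : IsAffineOpen U)
    {A : Type u} [CommRing A] [Algebra Γ(S, U) A] {iV : Spec (.of A) ⟶ G.left}
    (H : IsPullback iV (Spec.map (CommRingCat.ofHom (algebraMap Γ(S, U) A))) G.hom hU.fromSpec)
    {ε : A →ₐ[Γ(S, U)] Γ(S, U)}
    (hε : Spec.map (CommRingCat.ofHom ε.toRingHom) ≫ iV = hU.fromSpec ≫ η[G].left)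
    {n r : ℕ} (x : Fin r → A) (hx : ∀ i, x i ^ p ^ n = 0) (hxε : ∀ i, ε (x i) = 0) (f : Γ(S, U))
    (hli : LinearIndependent Γ(S, S.basicOpen f) fun α : Fin r → Fin (p ^ n) =>
      (1 : Γ(S, S.basicOpen f)) ⊗ₜ[Γ(S, U)] monom x fun i => (α i : ℕ))
    (hsp : Submodule.span Γ(S, S.basicOpen f) (Set.range fun α : Fin r → Fin (p ^ n) =>
      (1 : Γ(S, S.basicOpen f)) ⊗ₜ[Γ(S, U)] monom x fun i => (α i : ℕ)) = ⊤) :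
    ∃ e : (Over.pullback (S.basicOpen f).ι).obj G ≅ truncOver p n r ((S.basicOpen f).ι ≫ π),
      η[(Over.pullback (S.basicOpen f).ι).obj G] ≫ e.hom =
        truncSection p n r ((S.basicOpen f).ι ≫ π) := by
  have hU' := hU.basicOpen f
  have hres : Spec.map (CommRingCat.ofHom (algebraMap Γ(S, U) Γ(S, S.basicOpen f))) ≫
      hU.fromSpec = hU'.fromSpec := hU.map_fromSpec hU' _
  have H' := isPullback_chart_baseChange H hres
  let ε' : Γ(S, S.basicOpen f) ⊗[Γ(S, U)] A →ₐ[Γ(S, S.basicOpen f)] Γ(S, S.basicOpen f) :=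
    Algebra.TensorProduct.lift (AlgHom.id _ _) ((Algebra.ofId Γ(S, U) _).comp ε)
      fun _ _ => .all _ _
  have hε' : ∀ a, ε' (1 ⊗ₜ a) = algebraMap Γ(S, U) Γ(S, S.basicOpen f) (ε a) := fun a => by
    simp [ε', Algebra.ofId_apply]
  have hmono := (MorphismProperty.monomorphisms Scheme.{u}).of_isPullback H'.flip
    (MorphismProperty.monomorphisms.infer_property _)
  rw [MorphismProperty.monomorphisms.iff] at hmono
  have hmon : ∀ α : Fin r → ℕ,
      (1 : Γ(S, S.basicOpen f)) ⊗ₜ[Γ(S, U)] monom x α =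
        monom (fun i => (1 : Γ(S, S.basicOpen f)) ⊗ₜ[Γ(S, U)] x i) α := by
    intro α
    simp only [monom, Algebra.TensorProduct.tmul_pow, one_pow]
    exact map_prod (Algebra.TensorProduct.includeRight (R := Γ(S, U))
      (A := Γ(S, S.basicOpen f)) (B := A)) (fun i => x i ^ α i) Finset.univ
  simp only [hmon] at hli hsp
  refine exists_iso_truncOver p π G hU' H' (counit_chart_baseChange hε hres hε') _ (fun i => ?_)
    (fun i => ?_) hli hsp
  · rw [Algebra.TensorProduct.tmul_pow, hx, TensorProduct.tmul_zero]
  · rw [hε', hxε, map_zero]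

end AffineOpen

end

end NSmooth

/-! ### Assembly at a point of the base. -/

theorem propositionp (p : ℕ) [Fact p.Prime] (S : Scheme.{u})
    (π : S ⟶ Spec (.of (NSmooth.Fp.{u} p)))
    (G : Over S) [GrpObj G] [IsFinite G.hom] [Flat G.hom] [LocallyOfFinitePresentation G.hom]
    (n : ℕ) (hkilled : NSmooth.KilledByFrob p (NSmooth.natCast_of_Fp π) n G)
    (hexact : ∃ (m : ℕ) (_ : 1 ≤ m) (hmn : m < n),
      NSmooth.FpqcExact
        (NSmooth.relFrob p (NSmooth.natCast_of_Fp π) m G)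
        (NSmooth.relFrobTwist p (NSmooth.natCast_of_Fp π) hmn.le G)) :
    NSmooth.IsNSmooth p π n G := by
  obtain ⟨m, hm, hmn, hex⟩ := hexact
  intro s
  have hp : p.Prime := Fact.out
  obtain ⟨U, hU, hsU, -⟩ := exists_isAffineOpen_mem_and_subset (Opens.mem_top s)
  have hV : IsAffineOpen (G.hom ⁻¹ᵁ U) := hU.preimage G.hom
  let φ := G.hom.appLE U (G.hom ⁻¹ᵁ U) le_rfl
  let _ : Algebra Γ(S, U) Γ(G.left, G.hom ⁻¹ᵁ U) := φ.hom.toAlgebra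
  have H : IsPullback hV.fromSpec (Spec.map (CommRingCat.ofHom
      (algebraMap Γ(S, U) Γ(G.left, G.hom ⁻¹ᵁ U)))) G.hom hU.fromSpec :=
    NSmooth.isPullback_fromSpec_appLE G.hom hU hV
  have hfin : Module.Finite Γ(S, U) Γ(G.left, G.hom ⁻¹ᵁ U) := by
    have h := IsFinite.finite_app (f := G.hom) U hU
    rwa [← Scheme.Hom.appLE_eq_app] at h
  have hflat : Module.Flat Γ(S, U) Γ(G.left, G.hom ⁻¹ᵁ U) := G.hom.flat_appLE hU hV le_rfl
  have hfp : Algebra.FinitePresentation Γ(S, U) Γ(G.left, G.hom ⁻¹ᵁ U) :=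
    G.hom.finitePresentation_appLE hU hV le_rfl
  have hmfp := Module.FinitePresentation.of_finite_of_finitePresentation
    Γ(S, U) Γ(G.left, G.hom ⁻¹ᵁ U)
  have hR : (p : Γ(S, U)) = 0 := NSmooth.natCast_section p S (NSmooth.natCast_of_Fp π) U
  obtain ⟨ε, hε⟩ := NSmooth.exists_counit_algHom H
  obtain ⟨Δ, hl, hr⟩ := NSmooth.exists_comul_algHom H hε
  have hkill := NSmooth.pow_eq_zero_of_killedByFrob p (NSmooth.natCast_of_Fp π) H hε hR hkilled
  let P := (hU.primeIdealOf ⟨s, hsU⟩).asIdeal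
  -- The residue field may be imperfect; an algebraic closure has the `p^m`-th roots needed to use
  -- exactness.
  let k := AlgebraicClosure P.ResidueField
  have hk : CharP k p := by
    have h : (p : k) = 0 := by rw [← map_natCast (algebraMap Γ(S, U) k), hR, map_zero]
    exact (CharP.charP_iff_prime_eq_zero hp).2 h
  obtain ⟨f, hf, r, x, hxε, hx⟩ := NSmooth.exists_monom_basis_away k p hR ε Δ hl hr hm hmn hkill P
    fun l hl b => NSmooth.mem_frobIdeal_of_fpqcExact p _ H hε hmn.le hex k hl b
  have := hU.isLocalization_basicOpen f
  obtain ⟨hli, hsp⟩ := hx Γ(S, S.basicOpen f)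
    (TensorProduct Γ(S, U) Γ(S, S.basicOpen f) Γ(G.left, G.hom ⁻¹ᵁ U))
    (TensorProduct.mk Γ(S, U) _ _ 1)
  obtain ⟨e, he⟩ := NSmooth.exists_iso_truncOver_basicOpen p π G hU H hε x
    (fun i => hkill _ (hxε i)) hxε f hli hsp
  exact ⟨S.basicOpen f, NSmooth.mem_basicOpen_of_notMem_primeIdealOf hU hsU hf, r, e, he⟩
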